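/- **Setting.** Let $k$ be a field and $(X,Y,R,\check R,\Pi)$ a reduced, simply connected semisimple root datum (so the roots span $\mathbb Q\otimes X$ and $X$ contains the fundamental weights), with Weyl group $W\subset GL(X)$. Let $A=S_k(X)=k\otimes_{\mathbb Z}S_{\mathbb Z}(X)$ be the symmetric algebra, with generator $P_x$ attached to $x\in X$, and let $\mathfrak t=\operatorname{Hom}_{k\text{-alg}}(A,k)$ be the set of weights, with $\langle\lambda,x\rangle:=\lambda(P_x)$. For $\lambda\in\mathfrak t$ let $A_\lambda=A[f^{-1}\mid f(\lambda)\neq 0]$, with unit $1_\lambda$. The group $W$ acts on $A$ and on $\mathfrak t$, and each $w\in W$ induces $A_\lambda\to A_{w(\lambda)}$. Let $\Delta_\alpha(f)=(f-s_\alpha(f))/\alpha$ be the BGG operator (reduced from $\mathbb Z$ to $k$); it extends to $A_\lambda$ when $s_\alpha(\lambda)=\lambda$. For $\alpha,\beta\in\Pi$ distinct let $m_{\alpha,\beta}$ be the order of $s_\alpha s_\beta$, put $W^{\alpha,\beta}=\langle s_\alpha,s_\beta\rangle$ and let $w_{\alpha,\beta}$ be its longest element. A weight is standard parabolic for $W^{\alpha,\beta}$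 if its stabilizer in $W^{\alpha,\beta}$ is generated by a subset of $\{s_\alpha,s_\beta\}$, and parabolic for $W^{\alpha,\beta}$ if it is in the $W^{\alpha,\beta}$-orbit of such a weight. A weight $\lambda$ is $\alpha$-exceptional if $s_\alpha(\lambda)\ne\lambda$ and $\lambda$ is not parabolic for $W^{\alpha,\beta}$ for some $\beta\in\Pi$. A *datum* is a family $H=(H_\alpha^\lambda)_{\alpha\in\Pi,\lambda\in\mathfrak t}$ with $0\neq H^\lambda_\alpha\in A_\lambda$ such that 1. $s_\alpha(H_\alpha^\lambda)=H_\alpha^{s_\alpha(\lambda)}$; 2. $H_\alpha^\lambda=1$ if $s_\alpha(\lambda)=\lambda$; 3. $w_{\alpha,\beta}s_\alpha(H_\alpha^\lambda)=H_{w_{\alpha,\beta}s_\alpha(\alpha)}^{w_{\alpha,\beta}s_\alpha(\lambda)}$ for $\alpha\neq\beta$; 4. $H_\alpha^\lambda=1$ if $\lambda$ is $\alpha$-exceptional. The *localized quiver Hecke algebra* $\mathcal H(H)$ (with parameter $h_0=0$) is the non-unital $k$-algebra obtained from $\bigoplus_\lambda A_\lambda$ by adjoining elements $r_\alpha^\lambda$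 ($\alpha\in\Pi$, $\lambda\in\mathfrak t$) with the relations - $r_\alpha^\lambda1_\nu=1_{s_\alpha(\nu)}r_\alpha^\lambda=\delta_{\lambda,\nu}r_\alpha^\lambda$; - $r_\alpha^{s_\alpha(\lambda)}r_\alpha^\lambda=H_\alpha^\lambda$ if $s_\alpha(\lambda)\ne\lambda$, and $=0$ if $s_\alpha(\lambda)=\lambda$; - for $f\in A_\lambda$: $r_\alpha^\lambda f-s_\alpha(f)r_\alpha^\lambda=0$ if $s_\alpha(\lambda)\neq\lambda$, and $=\Delta_\alpha(f)$ if $s_\alpha(\lambda)=\lambda$; - the braid relations, with $m_{\alpha,\beta}$ factors on each side, $\cdots r_\beta^{s_\alpha(\lambda)}r_\alpha^\lambda=\cdots r_\alpha^{s_\beta(\lambda)}r_\beta^\lambda$, for $\alpha\neq\beta$ and $\lambda$ standard parabolic for $W^{\alpha,\beta}$, or not parabolic for $W^{\alpha,\beta}$ but fixed by one of $s_\alpha,s_\beta$; and then dividing by the right polynomial torsion, that is, by all $I=I1_\lambda$ with $If=0$ for some $0\ne f\in A_\lambda$. Assume that all $H_\alpha^\lambda$ lie in the image of $A\hookrightarrow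 A_\lambda$, and let $\mathcal H\subset\mathcal H(H)$ be the subalgebra generated by the images of $A$ in the $A_\lambda$ and by all the $r_\alpha^\lambda$. A *finite representation* of $\mathcal H(H)$ or of $\mathcal H$ is a finite-dimensional $k$-vector space $V$ with an action of the algebra such that $V=\sum_\lambda1_\lambda V$. **Proposition.** (a) Assume that $\Pi$ spans $k\otimes_{\mathbb Z}X$, i.e. that $A$ is generated by $\{P_\alpha\}_{\alpha\in\Pi}$. Then pullback along $\mathcal H\hookrightarrow\mathcal H(H)$ is an equivalence from the category of finite representations of $\mathcal H(H)$ to the full subcategory of those finite representations of $\mathcal H$ on which, for all $\alpha\in\Pi$ and $\lambda\in\mathfrak t$, the element $(P_\alpha-\langle\lambda,\alpha\rangle)^n1_\lambda$ acts by zero for all large enough $n$. (b) Without the assumption of (a), the same holds when the condition is imposed for all $x\in X$: the element $(P_x-\langle\lambda,x\rangle)^n1_\lambda$ acts by zero for all large enough $n$, for all $x\in X$ and $\lambda\in\mathfrak t$. -/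

import Mathlib

open scoped TensorProduct
open CategoryTheory

universe w

noncomputable section

namespace QuiverHecke

/-! ### The polynomial algebra, its fraction field, weights and localizations -/

section Polynomial

/-- The algebra `k[𝔱] = S_k(X) = k ⊗ S_ℤ(X)`. -/
abbrev PolyAlg (k X : Type*) [Field k] [AddCommGroup X] : Type _ :=
  SymmetricAlgebra k (k ⊗[ℤ] X)

/-- The generator `P_x` of `S_k(X)` attached to `x ∈ X`. -/
def polyGen (k : Type*) {X : Type*} [Field k] [AddCommGroup X] (x : X) : PolyAlg k X :=
  SymmetricAlgebra.ι k (k ⊗[ℤ] X) (1 ⊗ₜ[ℤ] x)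

/-- The field of fractions of `S_k(X)`. -/
abbrev FracAlg (k X : Type*) [Field k] [AddCommGroup X] : Type _ :=
  FractionRing (PolyAlg k X)

/-- The space of weights `𝔱 = Hom_{k-alg}(S_k(X), k)`. -/
abbrev Weight (k X : Type*) [Field k] [AddCommGroup X] : Type _ :=
  PolyAlg k X →ₐ[k] k

variable {k X : Type*} [Field k] [AddCommGroup X]

/-- The algebra endomorphism of `S_k(X)` induced by an endomorphism of `X`. -/
def polyMap (g : X →ₗ[ℤ] X) : PolyAlg k X →ₐ[k] PolyAlg k X :=
  SymmetricAlgebra.lift (SymmetricAlgebra.ι k (k ⊗[ℤ] X) ∘ₗ g.baseChange k)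

theorem polyMap_ι (g : X →ₗ[ℤ] X) (v : k ⊗[ℤ] X) :
    polyMap g (SymmetricAlgebra.ι k (k ⊗[ℤ] X) v) =
      SymmetricAlgebra.ι k (k ⊗[ℤ] X) (g.baseChange k v) := by
  simp [polyMap]

theorem polyMap_comp (g h : X →ₗ[ℤ] X) :
    (polyMap g).comp (polyMap h) = polyMap (k := k) (g ∘ₗ h) := by
  apply SymmetricAlgebra.algHom_ext
  ext v
  simp [polyMap_ι]

theorem polyMap_id : polyMap (LinearMap.id : X →ₗ[ℤ] X) = AlgHom.id k (PolyAlg k X) := by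
  apply SymmetricAlgebra.algHom_ext
  ext v
  simp [polyMap_ι]

/-- The action of `g ∈ GL(X)` on `S_k(X)`. -/
def polyAct (g : X ≃ₗ[ℤ] X) : PolyAlg k X ≃ₐ[k] PolyAlg k X :=
  AlgEquiv.ofAlgHom (polyMap g.toLinearMap) (polyMap g.symm.toLinearMap)
    (by rw [polyMap_comp]; simp [polyMap_id]) (by rw [polyMap_comp]; simp [polyMap_id])

theorem polyAct_polyGen (g : X ≃ₗ[ℤ] X) (x : X) :
    polyAct g (polyGen k x) = polyGen k (g x) := by
  simp [polyAct, polyGen, polyMap_ι]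

/-- The action of `g ∈ GL(X)` on weights: `(g λ)(f) = λ(g⁻¹ f)`. -/
def weightAct (g : X ≃ₗ[ℤ] X) (μ : Weight k X) : Weight k X :=
  μ.comp (polyAct g).symm.toAlgHom

theorem weightAct_polyAct (g : X ≃ₗ[ℤ] X) (μ : Weight k X) (a : PolyAlg k X) :
    weightAct g μ (polyAct g a) = μ a := by
  simp [weightAct]

/-- The action of `g ∈ GL(X)` on the field of fractions. -/
def fracAct (g : X ≃ₗ[ℤ] X) : FracAlg k X ≃+* FracAlg k X :=
  IsFractionRing.ringEquivOfRingEquiv (polyAct (k := k) g).toRingEquiv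

theorem fracAct_algebraMap (g : X ≃ₗ[ℤ] X) (a : PolyAlg k X) :
    fracAct g (algebraMap (PolyAlg k X) (FracAlg k X) a) =
      algebraMap (PolyAlg k X) (FracAlg k X) (polyAct g a) := by
  simp [fracAct]

theorem algebraMap_ne_zero_of_eval {μ : Weight k X} {b : PolyAlg k X} (hb : μ b ≠ 0) :
    algebraMap (PolyAlg k X) (FracAlg k X) b ≠ 0 := by
  intro h
  apply hb
  have : b = 0 := (IsFractionRing.injective (PolyAlg k X) (FracAlg k X)) (by simpa using h)
  simp [this]

variable [Module.Free ℤ X]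

/-- The localization `S_k(X)_λ` of `S_k(X)` at the weight `λ`: all fractions `a / b` with
`b(λ) ≠ 0`, inside the field of fractions. -/
def localAt (μ : Weight k X) : Subalgebra k (FracAlg k X) where
  carrier := {f | ∃ a b : PolyAlg k X, μ b ≠ 0 ∧
    f = algebraMap (PolyAlg k X) (FracAlg k X) a / algebraMap (PolyAlg k X) (FracAlg k X) b}
  mul_mem' := by
    rintro _ _ ⟨a, b, hb, rfl⟩ ⟨a', b', hb', rfl⟩
    exact ⟨a * a', b * b', by simp [hb, hb'], by simp [div_mul_div_comm]⟩
  add_mem' := by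
    rintro _ _ ⟨a, b, hb, rfl⟩ ⟨a', b', hb', rfl⟩
    refine ⟨a * b' + b * a', b * b', by simp [hb, hb'], ?_⟩
    rw [div_add_div _ _ (algebraMap_ne_zero_of_eval hb) (algebraMap_ne_zero_of_eval hb')]
    simp
  algebraMap_mem' c := ⟨algebraMap k (PolyAlg k X) c, 1, by simp, by
    simp [← IsScalarTower.algebraMap_apply]⟩

theorem algebraMap_mem_localAt (μ : Weight k X) (a : PolyAlg k X) :
    algebraMap (PolyAlg k X) (FracAlg k X) a ∈ localAt μ :=
  ⟨a, 1, by simp, by simp⟩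

/-- A polynomial regarded as an element of `S_k(X)_λ`. -/
def toLocal (μ : Weight k X) (a : PolyAlg k X) : localAt μ :=
  ⟨algebraMap (PolyAlg k X) (FracAlg k X) a, algebraMap_mem_localAt μ a⟩

theorem fracAct_mem_localAt (g : X ≃ₗ[ℤ] X) {μ : Weight k X} {f : FracAlg k X}
    (hf : f ∈ localAt μ) : fracAct g f ∈ localAt (weightAct g μ) := by
  obtain ⟨a, b, hb, rfl⟩ := hf
  exact ⟨polyAct g a, polyAct g b, by rwa [weightAct_polyAct], by
    rw [map_div₀, fracAct_algebraMap, fracAct_algebraMap]⟩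

/-- The map `S_k(X)_λ → S_k(X)_{g λ}` induced by `g ∈ GL(X)`. -/
def localAct (g : X ≃ₗ[ℤ] X) (μ : Weight k X) (f : localAt μ) : localAt (weightAct g μ) :=
  ⟨fracAct g f, fracAct_mem_localAt g f.2⟩

end Polynomial

/-! ### The BGG operators -/

section BGG

variable {ι k X Y : Type*} [Field k] [AddCommGroup X] [AddCommGroup Y] (P : RootDatum ι X Y)

/-- The `k`-linear functional `⟨·, α̌⟩` on `k ⊗ X`. -/
def corootFun (k : Type*) [Field k] (P : RootDatum ι X Y) (i : ι) : k ⊗[ℤ] X →ₗ[k] k :=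
  (TensorProduct.AlgebraTensorModule.rid ℤ k k).toLinearMap ∘ₗ
    LinearMap.baseChange k (P.coroot' i)

theorem corootFun_tmul (i : ι) (c : k) (x : X) :
    corootFun k P i (c ⊗ₜ[ℤ] x) = ((P.toLinearMap x (P.coroot i) : ℤ) : k) * c := by
  simp [corootFun]

/-- The algebra map `S_k(X) → S_k(X)[t]` with `P_x ↦ P_x - ⟨x, α̌⟩ t`. -/
def bggShift (i : ι) : PolyAlg k X →ₐ[k] Polynomial (PolyAlg k X) :=
  SymmetricAlgebra.lift
    ((Polynomial.CAlgHom (R := k) (A := PolyAlg k X)).toLinearMap ∘ₗ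
        SymmetricAlgebra.ι k (k ⊗[ℤ] X) -
      (LinearMap.toSpanSingleton k (Polynomial (PolyAlg k X)) Polynomial.X) ∘ₗ corootFun k P i)

/-- The BGG operator `Δ_α(f) = (f - s_α(f)) / α` on `S_k(X)`. So that it is the reduction of the
integral operator also when `α` vanishes in `k ⊗ X`, the division is carried out before `t` is
specialized to `P_α`: `f - bggShift f = t * q(t)` and `Δ_α(f) = q(P_α)`. -/
def bgg (i : ι) (f : PolyAlg k X) : PolyAlg k X :=
  -(bggShift P i f).divX.eval (polyGen k (P.root i))

theorem bggShift_ι (i : ι) (v : k ⊗[ℤ] X) :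
    bggShift P i (SymmetricAlgebra.ι k (k ⊗[ℤ] X) v) =
      Polynomial.C (SymmetricAlgebra.ι k (k ⊗[ℤ] X) v) - corootFun k P i v • Polynomial.X := by
  simp [bggShift]

theorem bggShift_coeff_zero (i : ι) (f : PolyAlg k X) : (bggShift P i f).coeff 0 = f := by
  have h : ((Polynomial.aeval (R := PolyAlg k X) (0 : PolyAlg k X)).restrictScalars k).comp
      (bggShift P i) = AlgHom.id k (PolyAlg k X) := by
    apply SymmetricAlgebra.algHom_ext
    ext v
    simp [bggShift_ι]
  have := DFunLike.congr_fun h f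
  simpa [Polynomial.coeff_zero_eq_aeval_zero] using this

theorem bggShift_eval (i : ι) (f : PolyAlg k X) :
    (bggShift P i f).eval (polyGen k (P.root i)) = polyAct (P.reflection i) f := by
  have h : ((Polynomial.aeval (R := PolyAlg k X) (polyGen k (P.root i))).restrictScalars k).comp
      (bggShift P i) = (polyAct (P.reflection i)).toAlgHom := by
    apply SymmetricAlgebra.algHom_ext
    ext v
    have h1 := polyAct_polyGen (k := k) (P.reflection i) v
    simp only [polyGen] at h1
    simp [bggShift_ι, h1, corootFun_tmul, polyGen, RootPairing.reflection_apply,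
      TensorProduct.tmul_sub, TensorProduct.tmul_smul, Algebra.smul_def]
  have := DFunLike.congr_fun h f
  simpa [Polynomial.aeval_def] using this

/-- `α Δ_α(f) = f - s_α(f)`. -/
theorem root_mul_bgg (i : ι) (f : PolyAlg k X) :
    polyGen k (P.root i) * bgg P i f = f - polyAct (P.reflection i) f := by
  have h := congrArg (Polynomial.eval (polyGen k (P.root i)))
    (Polynomial.X_mul_divX_add (bggShift P i f))
  rw [bggShift_eval, bggShift_coeff_zero] at h
  simp only [Polynomial.eval_add, Polynomial.eval_mul, Polynomial.eval_X,
    Polynomial.eval_C] at h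
  rw [bgg, ← h]
  ring

/-- `Δ_α(P_x) = ⟨x, α̌⟩`. -/
theorem bgg_polyGen (i : ι) (x : X) :
    bgg P i (polyGen k x) =
      algebraMap k (PolyAlg k X) ((P.toLinearMap x (P.coroot i) : ℤ) : k) := by
  have h : (bggShift P i (polyGen k x)).divX =
      -Polynomial.C (algebraMap k (PolyAlg k X) ((P.toLinearMap x (P.coroot i) : ℤ) : k)) := by
    ext n
    rw [polyGen, bggShift_ι, corootFun_tmul, Polynomial.coeff_divX]
    simp [Algebra.smul_def]
  simp [bgg, h]

variable [Module.Free ℤ X]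

/-- `Δ_α(f g) = Δ_α(f) s_α(g) + f Δ_α(g)`. -/
theorem bgg_mul (i : ι) (f g : PolyAlg k X) :
    bgg P i (f * g) = bgg P i f * polyAct (P.reflection i) g + f * bgg P i g := by
  have h : (bggShift P i (f * g)).divX =
      (bggShift P i f).divX * bggShift P i g + Polynomial.C f * (bggShift P i g).divX := by
    apply mul_left_cancel₀ (Polynomial.X_ne_zero (R := PolyAlg k X))
    have h1 := Polynomial.X_mul_divX_add (bggShift P i (f * g))
    have h2 := Polynomial.X_mul_divX_add (bggShift P i f)
    have h3 := Polynomial.X_mul_divX_add (bggShift P i g)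
    rw [bggShift_coeff_zero] at h1 h2 h3
    have h4 := map_mul (bggShift P i) f g
    have h5 := Polynomial.C_mul (a := f) (b := g)
    linear_combination h1 - bggShift P i g * h2 - Polynomial.C f * h3 + h4 - h5
  simp only [bgg, h, Polynomial.eval_add, Polynomial.eval_mul, Polynomial.eval_C, bggShift_eval]
  ring

/-- The extension of `Δ_α` to fractions: `Δ_α(f) = (Δ_α(a) - s_α(f) Δ_α(b)) / b` for
`f = a / b`. -/
def fracBgg (i : ι) (f : FracAlg k X) : FracAlg k X :=
  (algebraMap (PolyAlg k X) (FracAlg k X)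
        (bgg P i (IsLocalization.sec (nonZeroDivisors (PolyAlg k X)) f).1) -
      fracAct (P.reflection i) f * algebraMap (PolyAlg k X) (FracAlg k X)
        (bgg P i (IsLocalization.sec (nonZeroDivisors (PolyAlg k X)) f).2)) /
    algebraMap (PolyAlg k X) (FracAlg k X)
      (IsLocalization.sec (nonZeroDivisors (PolyAlg k X)) f).2

/-- The value of `fracBgg` does not depend on the fraction `a / b`. -/
theorem fracBgg_div (i : ι) (a b : PolyAlg k X) (hb : b ≠ 0) :
    fracBgg P i (algebraMap (PolyAlg k X) (FracAlg k X) a /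
        algebraMap (PolyAlg k X) (FracAlg k X) b) =
      (algebraMap (PolyAlg k X) (FracAlg k X) (bgg P i a) -
        fracAct (P.reflection i) (algebraMap (PolyAlg k X) (FracAlg k X) a /
          algebraMap (PolyAlg k X) (FracAlg k X) b) *
        algebraMap (PolyAlg k X) (FracAlg k X) (bgg P i b)) /
      algebraMap (PolyAlg k X) (FracAlg k X) b := by
  have inj : Function.Injective (algebraMap (PolyAlg k X) (FracAlg k X)) :=
    IsFractionRing.injective _ _
  have hb' : algebraMap (PolyAlg k X) (FracAlg k X) b ≠ 0 := by
    simpa using (map_ne_zero_iff _ inj).2 hb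
  set f := algebraMap (PolyAlg k X) (FracAlg k X) a / algebraMap (PolyAlg k X) (FracAlg k X) b
    with hf
  unfold fracBgg
  have hs := IsLocalization.sec_spec (nonZeroDivisors (PolyAlg k X)) f
  have hd0 : ((IsLocalization.sec (nonZeroDivisors (PolyAlg k X)) f).2 : PolyAlg k X) ≠ 0 :=
    nonZeroDivisors.ne_zero (IsLocalization.sec (nonZeroDivisors (PolyAlg k X)) f).2.2
  generalize (IsLocalization.sec (nonZeroDivisors (PolyAlg k X)) f).1 = c at *
  generalize ((IsLocalization.sec (nonZeroDivisors (PolyAlg k X)) f).2 : PolyAlg k X) = d at *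
  have hd : algebraMap (PolyAlg k X) (FracAlg k X) d ≠ 0 := (map_ne_zero_iff _ inj).2 hd0
  have hab : f * algebraMap (PolyAlg k X) (FracAlg k X) b =
      algebraMap (PolyAlg k X) (FracAlg k X) a := by rw [hf]; field_simp
  have hcb : a * d = c * b := by
    apply inj
    rw [map_mul, map_mul, ← hab, ← hs]
    ring
  have e1 := congrArg (algebraMap (PolyAlg k X) (FracAlg k X)) (congrArg (bgg P i) hcb)
  have e2 := congrArg (fun x => algebraMap (PolyAlg k X) (FracAlg k X) (bgg P i x))
    (mul_comm b d)
  have e3 := congrArg (fracAct (P.reflection i)) hab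
  have e4 := congrArg (fracAct (P.reflection i)) hs
  rw [mul_comm a d, mul_comm c b] at e1
  simp only [bgg_mul, map_add, map_mul, fracAct_algebraMap] at e1 e2 e3 e4
  rw [div_eq_div_iff hd hb']
  linear_combination -e1 - fracAct (P.reflection i) f * e2 -
    algebraMap (PolyAlg k X) (FracAlg k X) (bgg P i d) * e3 +
    algebraMap (PolyAlg k X) (FracAlg k X) (bgg P i b) * e4

/-- `α Δ_α(f) = f - s_α(f)` on fractions. -/
theorem root_mul_fracBgg (i : ι) (f : FracAlg k X) :
    algebraMap (PolyAlg k X) (FracAlg k X) (polyGen k (P.root i)) * fracBgg P i f =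
      f - fracAct (P.reflection i) f := by
  obtain ⟨a, b, hb, rfl⟩ := IsFractionRing.div_surjective (A := PolyAlg k X) f
  have hb0 : b ≠ 0 := nonZeroDivisors.ne_zero hb
  have hb' : algebraMap (PolyAlg k X) (FracAlg k X) b ≠ 0 := by
    simpa using hb0
  have h1 := congrArg (algebraMap (PolyAlg k X) (FracAlg k X)) (root_mul_bgg P i a)
  have h2 := congrArg (algebraMap (PolyAlg k X) (FracAlg k X)) (root_mul_bgg P i b)
  have hsb : algebraMap (PolyAlg k X) (FracAlg k X) (polyAct (P.reflection i) b) ≠ 0 := by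
    simpa using hb0
  rw [fracBgg_div P i a b hb0, map_div₀, fracAct_algebraMap, fracAct_algebraMap]
  simp only [map_mul, map_sub] at h1 h2
  field_simp
  linear_combination algebraMap (PolyAlg k X) (FracAlg k X) (polyAct (P.reflection i) b) * h1 -
    algebraMap (PolyAlg k X) (FracAlg k X) (polyAct (P.reflection i) a) * h2

theorem fracBgg_mem_localAt (i : ι) {μ : Weight k X} (hμ : weightAct (P.reflection i) μ = μ)
    {f : FracAlg k X} (hf : f ∈ localAt μ) : fracBgg P i f ∈ localAt μ := by
  have hs : fracAct (P.reflection i) f ∈ localAt μ := by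
    have := fracAct_mem_localAt (P.reflection i) hf
    rwa [hμ] at this
  obtain ⟨a, b, hb, rfl⟩ := hf
  have hb0 : b ≠ 0 := by rintro rfl; simp at hb
  rw [fracBgg_div P i a b hb0, div_eq_mul_inv]
  refine mul_mem (sub_mem (algebraMap_mem_localAt μ _)
    (mul_mem hs (algebraMap_mem_localAt μ _))) ⟨1, b, hb, by simp⟩

/-- The operator `Δ_α` on `S_k(X)_λ` for a weight `λ` fixed by `s_α`. -/
def localBgg (i : ι) (μ : Weight k X) (hμ : weightAct (P.reflection i) μ = μ) (f : localAt μ) :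
    localAt μ :=
  ⟨fracBgg P i f, fracBgg_mem_localAt P i hμ f.2⟩

end BGG

/-! ### Weyl group, parabolic weights and the datum `G` -/

section Datum

variable {ι k X Y : Type*} [Field k] [AddCommGroup X] [AddCommGroup Y]

/-- The root datum is semisimple (the roots span `ℚ ⊗ X`) and simply connected (`X` contains the
fundamental weights). -/
structure IsSimplyConnectedSemisimple (P : RootDatum ι X Y) (b : P.Base) : Prop where
  semisimple : ∀ x : X, ∃ n : ℤ, n ≠ 0 ∧ n • x ∈ Submodule.span ℤ (Set.range P.root)
  fundamental : ∀ i ∈ b.support, ∃ ω : X, P.toLinearMap ω (P.coroot i) = 1 ∧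
    ∀ j ∈ b.support, j ≠ i → P.toLinearMap ω (P.coroot j) = 0

/-- The alternating word `i, j, i, j, …` with `n` letters. -/
def altWord {S : Type*} (i j : S) : ℕ → List S
  | 0 => []
  | n + 1 => i :: altWord j i n

variable (P : RootDatum ι X Y) (b : P.Base)

/-- The product of simple reflections along a word, the first letter acting first. -/
def wordElt : List b.support → (X ≃ₗ[ℤ] X)
  | [] => 1
  | i :: l => wordElt l * P.reflection i

/-- The order `m_{α,β}` of `s_α s_β`. -/
def coxeterOrder (i j : b.support) : ℕ :=
  orderOf (P.reflection i * P.reflection j : X ≃ₗ[ℤ] X)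

/-- The longest element `w_{α,β}` of `⟨s_α, s_β⟩`, for `α ≠ β`. -/
def longestElt (i j : b.support) : X ≃ₗ[ℤ] X :=
  wordElt P b (altWord i j (coxeterOrder P b i j))

/-- The subgroup of `GL(X)` generated by the simple reflections in `S`; for `S = {α, β}` it is
`W^{α,β}`. -/
def reflSubgroup (S : Set b.support) : Subgroup (X ≃ₗ[ℤ] X) :=
  Subgroup.closure ((fun i : b.support => (P.reflection i : X ≃ₗ[ℤ] X)) '' S)

/-- The stabilizer of `λ` in `W^{α,β}` is generated by a subset of `{s_α, s_β}`. -/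
def IsStandardParabolic (i j : b.support) (μ : Weight k X) : Prop :=
  ∃ S ⊆ ({i, j} : Set b.support), ∀ w ∈ reflSubgroup P b {i, j},
    weightAct w μ = μ ↔ w ∈ reflSubgroup P b S

/-- `λ` lies in the `W^{α,β}`-orbit of a weight that is standard parabolic with respect to
`W^{α,β}`. -/
def IsParabolic (i j : b.support) (μ : Weight k X) : Prop :=
  ∃ w ∈ reflSubgroup P b {i, j}, IsStandardParabolic P b i j (weightAct w μ)

/-- `λ` is `α`-exceptional. -/
def IsExceptional (i : b.support) (μ : Weight k X) : Prop :=
  (∃ j : b.support, ¬ IsParabolic P b i j μ) ∧ weightAct (P.reflection i) μ ≠ μ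

/-- A datum `G = (G_α^λ)` of non-zero elements `G_α^λ ∈ S_k(X)_λ` satisfying the conditions needed
to define the localized quiver Hecke algebra. -/
structure Datum (k : Type*) [Field k] [Module.Free ℤ X] where
  G : b.support → Weight k X → FracAlg k X
  mem_localAt : ∀ i μ, G i μ ∈ localAt μ
  ne_zero : ∀ i μ, G i μ ≠ 0
  associative : ∀ (i : b.support) (μ : Weight k X), fracAct (P.reflection i) (G i μ) = G i (weightAct (P.reflection i) μ)
  eq_one_of_fixed : ∀ (i : b.support) (μ : Weight k X), weightAct (P.reflection i) μ = μ → G i μ = 1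
  /-- `w_{α,β} s_α (G_α^λ) = G_{w_{α,β} s_α(α)}^{w_{α,β} s_α(λ)}`, where `w_{α,β} s_α(α)` is `α` for
  `m_{α,β}` even and `β` for `m_{α,β}` odd. -/
  braid : ∀ (i j : b.support) (μ : Weight k X), i ≠ j →
    fracAct (longestElt P b i j * P.reflection i) (G i μ) =
      G (if Even (coxeterOrder P b i j) then i else j)
        (weightAct (longestElt P b i j * P.reflection i) μ)
  eq_one_of_exceptional : ∀ i μ, IsExceptional P b i μ → G i μ = 1

variable {P b}

/-- All `G_α^λ` lie in the image of `S_k(X)` in `S_k(X)_λ`. -/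
def Datum.IsPolynomial [Module.Free ℤ X] (D : Datum P b k) : Prop :=
  ∀ i μ, D.G i μ ∈ Set.range (algebraMap (PolyAlg k X) (FracAlg k X))

end Datum

/-! ### The localized quiver Hecke algebra (with `h₀ = 0`) -/

section Algebra

variable {ι k X Y : Type*} [Field k] [AddCommGroup X] [AddCommGroup Y] [Module.Free ℤ X]
  {P : RootDatum ι X Y} {b : P.Base}

/-- The generators: the elements of `⨁ S_k(X)_λ`, supported at one weight, and the `r_α^λ`. -/
inductive Gen (k : Type*) [Field k] (b : P.Base)
  | loc (μ : Weight k X) (f : localAt μ) : Gen k b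
  | arr (i : b.support) (μ : Weight k X) : Gen k b

/-- The generator `f 1_λ`, for `f ∈ S_k(X)_λ`, of the free algebra. -/
def fLoc (b : P.Base) (μ : Weight k X) (f : localAt μ) : FreeAlgebra k (Gen k b) :=
  FreeAlgebra.ι k (Gen.loc μ f)

/-- The generator `r_α^λ` of the free algebra. -/
def fArr (b : P.Base) (i : b.support) (μ : Weight k X) : FreeAlgebra k (Gen k b) :=
  FreeAlgebra.ι k (Gen.arr i μ)

/-- The product `r_{α_m}^{λ_m} ⋯ r_{α_1}^{λ_1}` for a word `α_1, …, α_m`, where `λ_1 = λ` and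
`λ_{n+1} = s_{α_n}(λ_n)`. -/
def fWord (b : P.Base) : List b.support → Weight k X → FreeAlgebra k (Gen k b)
  | [], μ => fLoc b μ 1
  | i :: l, μ => fWord b l (weightAct (P.reflection i) μ) * fArr b i μ

/-- The defining relations before torsion is divided out. -/
inductive Rel (D : Datum P b k) : FreeAlgebra k (Gen k b) → FreeAlgebra k (Gen k b) → Prop
  -- the relations of the non-unital algebra `⨁ S_k(X)_λ`
  | loc_add (μ : Weight k X) (f g : localAt μ) :
      Rel D (fLoc b μ (f + g)) (fLoc b μ f + fLoc b μ g)
  | loc_smul (μ : Weight k X) (c : k) (f : localAt μ) :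
      Rel D (fLoc b μ (c • f)) (c • fLoc b μ f)
  | loc_mul (μ : Weight k X) (f g : localAt μ) :
      Rel D (fLoc b μ f * fLoc b μ g) (fLoc b μ (f * g))
  | loc_mul_of_ne (μ ν : Weight k X) (f : localAt μ) (g : localAt ν) (h : μ ≠ ν) :
      Rel D (fLoc b μ f * fLoc b ν g) 0
  -- `r_α^λ 1_ν = 1_{s_α(ν)} r_α^λ = δ_{λ,ν} r_α^λ`
  | arr_one (i : b.support) (μ : Weight k X) : Rel D (fArr b i μ * fLoc b μ 1) (fArr b i μ)
  | arr_one_of_ne (i : b.support) (μ ν : Weight k X) (h : μ ≠ ν) :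
      Rel D (fArr b i μ * fLoc b ν 1) 0
  | one_arr (i : b.support) (μ : Weight k X) :
      Rel D (fLoc b (weightAct (P.reflection i) μ) 1 * fArr b i μ) (fArr b i μ)
  | one_arr_of_ne (i : b.support) (μ ν : Weight k X) (h : μ ≠ ν) :
      Rel D (fLoc b (weightAct (P.reflection i) ν) 1 * fArr b i μ) 0
  -- the quadratic relations
  | quad_of_ne (i : b.support) (μ : Weight k X) (h : weightAct (P.reflection i) μ ≠ μ) :
      Rel D (fArr b i (weightAct (P.reflection i) μ) * fArr b i μ)
        (fLoc b μ ⟨D.G i μ, D.mem_localAt i μ⟩)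
  | quad_of_eq (i : b.support) (μ : Weight k X) (h : weightAct (P.reflection i) μ = μ) :
      Rel D (fArr b i (weightAct (P.reflection i) μ) * fArr b i μ) 0
  -- the commutation relations
  | comm_of_ne (i : b.support) (μ : Weight k X) (h : weightAct (P.reflection i) μ ≠ μ)
      (f : localAt μ) :
      Rel D (fArr b i μ * fLoc b μ f -
        fLoc b (weightAct (P.reflection i) μ) (localAct (P.reflection i) μ f) * fArr b i μ) 0
  | comm_of_eq (i : b.support) (μ : Weight k X) (h : weightAct (P.reflection i) μ = μ)
      (f : localAt μ) :
      Rel D (fArr b i μ * fLoc b μ f -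
        fLoc b (weightAct (P.reflection i) μ) (localAct (P.reflection i) μ f) * fArr b i μ)
        (fLoc b μ (localBgg P i μ h f))
  -- the braid relations
  | braid (i j : b.support) (hij : i ≠ j) (μ : Weight k X)
      (h : IsStandardParabolic P b i j μ ∨ (¬ IsParabolic P b i j μ ∧
        (weightAct (P.reflection i) μ = μ ∨ weightAct (P.reflection j) μ = μ))) :
      Rel D (fWord b (altWord i j (coxeterOrder P b i j)) μ)
        (fWord b (altWord j i (coxeterOrder P b i j)) μ)

/-- The unitization of the algebra presented by `Rel`: the unital algebra with these generators
and relations. No relation has a constant term, so the non-unital algebra with these generators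
and relations is the non-unital subalgebra generated by the generators. -/
abbrev PreHecke (D : Datum P b k) : Type _ := RingQuot (Rel D)

/-- The element `f 1_λ` of `PreHecke D`. -/
def pLoc (D : Datum P b k) (μ : Weight k X) (f : localAt μ) : PreHecke D :=
  RingQuot.mkAlgHom k (Rel D) (fLoc b μ f)

/-- Right polynomial torsion is divided out: `I` becomes `0` if `I = I 1_λ` and `I f = 0` for some
non-zero `f ∈ S_k(X)_λ`. -/
inductive TorsionRel (D : Datum P b k) : PreHecke D → PreHecke D → Prop
  | torsion (μ : Weight k X) (I : PreHecke D) (hI : I * pLoc D μ 1 = I) (f : localAt μ)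
      (hf : f ≠ 0) (h : I * pLoc D μ f = 0) : TorsionRel D I 0

/-- The unitization of the localized quiver Hecke algebra. -/
abbrev UnitalHecke (D : Datum P b k) : Type _ := RingQuot (TorsionRel D)

/-- The element `f 1_λ`, for `f ∈ S_k(X)_λ`. -/
def loc (D : Datum P b k) (μ : Weight k X) (f : localAt μ) : UnitalHecke D :=
  RingQuot.mkAlgHom k (TorsionRel D) (pLoc D μ f)

/-- The element `r_α^λ`. -/
def arr (D : Datum P b k) (i : b.support) (μ : Weight k X) : UnitalHecke D :=
  RingQuot.mkAlgHom k (TorsionRel D) (RingQuot.mkAlgHom k (Rel D) (fArr b i μ))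

/-- The localized quiver Hecke algebra `𝓗(G)`, a non-unital algebra. -/
def localizedHecke (D : Datum P b k) : NonUnitalSubalgebra k (UnitalHecke D) :=
  NonUnitalAlgebra.adjoin k
    ({x | ∃ (μ : Weight k X) (f : localAt μ), x = loc D μ f} ∪
      {x | ∃ (i : b.support) (μ : Weight k X), x = arr D i μ})

/-- The quiver Hecke algebra `𝓗`: the subalgebra generated by the images of
`S_k(X) → S_k(X)_λ` and the `r_α^λ`. -/
def quiverHecke (D : Datum P b k) : NonUnitalSubalgebra k (UnitalHecke D) :=
  NonUnitalAlgebra.adjoin k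
    ({x | ∃ (μ : Weight k X) (a : PolyAlg k X), x = loc D μ (toLocal μ a)} ∪
      {x | ∃ (i : b.support) (μ : Weight k X), x = arr D i μ})

theorem quiverHecke_le (D : Datum P b k) : quiverHecke D ≤ localizedHecke D := by
  refine NonUnitalAlgebra.adjoin_mono (Set.union_subset_union_left _ ?_)
  rintro _ ⟨μ, a, rfl⟩
  exact ⟨μ, _, rfl⟩

/-- The inclusion of `𝓗` into the localized algebra. -/
def quiverHeckeIncl (D : Datum P b k) : quiverHecke D →ₙₐ[k] localizedHecke D :=
  NonUnitalSubalgebra.inclusion (quiverHecke_le D)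

/-- The element `a 1_λ` of `𝓗`, for a polynomial `a`. -/
def polyAt (D : Datum P b k) (μ : Weight k X) (a : PolyAlg k X) : quiverHecke D :=
  ⟨loc D μ (toLocal μ a), NonUnitalAlgebra.subset_adjoin k (Or.inl ⟨μ, a, rfl⟩)⟩

/-- The idempotent `1_λ` of `𝓗`. -/
def idem (D : Datum P b k) (μ : Weight k X) : quiverHecke D := polyAt D μ 1

/-- The idempotent `1_λ` of the localized algebra. -/
def localizedIdem (D : Datum P b k) (μ : Weight k X) : localizedHecke D :=
  ⟨loc D μ 1, NonUnitalAlgebra.subset_adjoin k (Or.inl ⟨μ, 1, rfl⟩)⟩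

theorem incl_idem (D : Datum P b k) (μ : Weight k X) :
    quiverHeckeIncl D (idem D μ) = localizedIdem D μ := by
  have h : toLocal μ (1 : PolyAlg k X) = 1 := Subtype.ext (map_one _)
  apply Subtype.ext
  change loc D μ (toLocal μ 1) = loc D μ 1
  rw [h]

end Algebra

/-! ### Finite representations of locally unital algebras -/

section Rep

/-- Finite (that is, finite-dimensional) representations of a non-unital algebra `B` with a family
`e` of idempotents, on which `B` acts in a locally unital way: `V = ∑ e_t V`. -/
structure FinRep {T k B : Type*} [Field k] [NonUnitalSemiring B] [Module k B] (e : T → B) where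
  carrier : Type w
  [addCommGroup : AddCommGroup carrier]
  [module : Module k carrier]
  [finite : FiniteDimensional k carrier]
  ρ : B →ₙₐ[k] Module.End k carrier
  iSup_range : ⨆ t, LinearMap.range (ρ (e t)) = ⊤

attribute [instance] FinRep.addCommGroup FinRep.module FinRep.finite

variable {T k B C : Type*} [Field k] [NonUnitalSemiring B] [Module k B] [NonUnitalSemiring C] [Module k C]

/-- Morphisms of representations: linear maps commuting with the action. -/
@[ext]
structure FinRep.Hom {e : T → B} (V W : FinRep.{w} (k := k) e) where
  toLin : V.carrier →ₗ[k] W.carrier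
  comm : ∀ x : B, toLin ∘ₗ V.ρ x = W.ρ x ∘ₗ toLin

instance FinRep.category (e : T → B) : Category (FinRep.{w} (k := k) e) where
  Hom V W := FinRep.Hom V W
  id V := ⟨LinearMap.id, fun _ => rfl⟩
  comp f g := ⟨g.toLin ∘ₗ f.toLin, fun x => by
    rw [LinearMap.comp_assoc, f.comm, ← LinearMap.comp_assoc, g.comm, LinearMap.comp_assoc]⟩

/-- Pullback of representations along an algebra morphism that preserves the idempotents. -/
def FinRep.pullback {e : T → B} {e' : T → C} (φ : B →ₙₐ[k] C) (h : ∀ t, φ (e t) = e' t) :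
    FinRep.{w} (k := k) e' ⥤ FinRep.{w} (k := k) e where
  obj V :=
    { carrier := V.carrier
      ρ := V.ρ.comp φ
      iSup_range := by simpa [h] using V.iSup_range }
  map f := ⟨f.toLin, fun x => f.comm (φ x)⟩

end Rep

section Main

variable {ι k X Y : Type*} [Field k] [AddCommGroup X] [AddCommGroup Y] [Module.Free ℤ X]
  {P : RootDatum ι X Y} {b : P.Base}

/-- Pullback of finite representations along `𝓗 ↪ 𝓗(G)`. -/
def pullbackFunctor (D : Datum P b k) :
    FinRep.{w} (k := k) (localizedIdem D) ⥤ FinRep.{w} (k := k) (idem D) :=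
  FinRep.pullback (quiverHeckeIncl D) (incl_idem D)

/-- For all `x ∈ S` and all weights `λ`, `(P_x - ⟨λ, x⟩)^n 1_λ` acts by zero for large `n`. -/
def IsNilpotentOn (D : Datum P b k) (S : Set X) :
    ObjectProperty (FinRep.{w} (k := k) (idem D)) := fun V =>
  ∀ μ : Weight k X, ∀ x ∈ S, ∃ N : ℕ, ∀ n ≥ N,
    V.ρ (polyAt D μ ((polyGen k x - algebraMap k (PolyAlg k X) (μ (polyGen k x))) ^ n)) = 0

/-- Pullback along `𝓗 ↪ 𝓗(G)` takes its values in the full subcategory of the finite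
representations of `𝓗` satisfying `Q`, and is an equivalence onto it. -/
def PullbackIsEquivalenceOnto (D : Datum P b k)
    (Q : ObjectProperty (FinRep.{w} (k := k) (idem D))) : Prop :=
  ∃ h : ∀ V, Q ((pullbackFunctor.{w} D).obj V), (Q.lift (pullbackFunctor.{w} D) h).IsEquivalence

end Main

end QuiverHecke

end

/-! Let `V` be a representation of `𝓗` such that each polynomial `a` with `a(λ) ≠ 0` acts invertibly
on `1_λ V` (`IsLocalizable`). Passing to `𝓗(H)` only inverts such polynomials, so `V` should carry
exactly one action of `𝓗(H)` extending the given one. The nilpotency condition guarantees this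
invertibility and, on finite-dimensional spaces, is forced by it.

Fully faithful: the functor keeps the underlying spaces and linear maps, and a map commuting with an
operator commutes with its inverse (`commutes_of_commutes_quiverHecke`).

Pullbacks are nilpotent: let `a = P_x - ⟨λ, x⟩` act on `1_λ V` and write the minimal polynomial of
this operator as `t^N q(t)` with `q(0) ≠ 0`. The polynomial `q(a)` does not vanish at `λ`, so it is
a unit in `A_λ` and can be cancelled, leaving `a^N = 0` on `1_λ V` (`exists_polyEnd_pow_eq_zero`).
This is where finite dimension enters.

Essentially surjective: if the `P_x - ⟨λ, x⟩` act nilpotently for `x` in a spanning set, then so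
does `a - a(λ)` for every polynomial `a`. Hence `a` is invertible on `1_λ V` when `a(λ) ≠ 0`, with
an inverse that is again the action of a polynomial (`isLocalizable_of_isNilpotentOn`). A fraction
therefore acts through a polynomial, which defines an action of the free algebra, and two things
remain to be checked.

The defining relations (`IsLocalizable.freeEnd_rel`): a relation between elements of `𝓗` holds on
`V` for free, since `𝓗` sits inside the quotient. The quadratic relation is of this kind because the
`H_α^λ` are polynomial. Relations involving fractions follow by clearing denominators.

The torsion relations (`IsLocalizable.preEnd_torsionRel`): every `x` has, for each `λ`, a multiple
`x c 1_λ` coming from `𝓗` with `c(λ) ≠ 0` (`hasDenominators`). For torsion `x` that multiple is zero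
in the quotient, so it acts by zero, and `c` can be cancelled. -/

noncomputable section

namespace QuiverHecke

/-! ### Relations between polynomials and the `r_α^λ` in the quotient and in `𝓗` -/

section Relations

variable {ι k X Y : Type*} [Field k] [AddCommGroup X] [AddCommGroup Y] [Module.Free ℤ X]
  {P : RootDatum ι X Y} {b : P.Base}

/-- The quotient map from the free algebra to the unitization of the localized algebra. -/
def toUnital (D : Datum P b k) : FreeAlgebra k (Gen k b) →ₐ[k] UnitalHecke D :=
  (RingQuot.mkAlgHom k (TorsionRel D)).comp (RingQuot.mkAlgHom k (Rel D))

theorem toUnital_eq_of_rel {D : Datum P b k} {x y : FreeAlgebra k (Gen k b)} (h : Rel D x y) :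
    toUnital D x = toUnital D y :=
  congrArg (RingQuot.mkAlgHom k (TorsionRel D)) (RingQuot.mkAlgHom_rel k h)

/-- The element `r_α^λ` of `PreHecke D`. -/
def pArr (D : Datum P b k) (i : b.support) (μ : Weight k X) : PreHecke D :=
  RingQuot.mkAlgHom k (Rel D) (fArr b i μ)

theorem pLoc_add (D : Datum P b k) (μ : Weight k X) (f g : localAt μ) :
    pLoc D μ (f + g) = pLoc D μ f + pLoc D μ g := by
  have := RingQuot.mkAlgHom_rel k (Rel.loc_add (D := D) μ f g)
  rwa [map_add] at this

theorem pLoc_smul (D : Datum P b k) (μ : Weight k X) (c : k) (f : localAt μ) :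
    pLoc D μ (c • f) = c • pLoc D μ f := by
  have := RingQuot.mkAlgHom_rel k (Rel.loc_smul (D := D) μ c f)
  rwa [map_smul] at this

theorem pLoc_mul (D : Datum P b k) (μ : Weight k X) (f g : localAt μ) :
    pLoc D μ (f * g) = pLoc D μ f * pLoc D μ g := by
  have := (RingQuot.mkAlgHom_rel k (Rel.loc_mul (D := D) μ f g)).symm
  rwa [map_mul] at this

theorem pLoc_mul_of_ne (D : Datum P b k) {μ ν : Weight k X} (h : μ ≠ ν) (f : localAt μ)
    (g : localAt ν) : pLoc D μ f * pLoc D ν g = 0 := by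
  have := RingQuot.mkAlgHom_rel k (Rel.loc_mul_of_ne (D := D) μ ν f g h)
  rwa [map_mul, map_zero] at this

theorem pArr_mul_pLoc_of_ne (D : Datum P b k) (i : b.support) {μ : Weight k X}
    (h : weightAct (P.reflection i) μ ≠ μ) (f : localAt μ) :
    pArr D i μ * pLoc D μ f =
      pLoc D (weightAct (P.reflection i) μ) (localAct (P.reflection i) μ f) * pArr D i μ := by
  have := RingQuot.mkAlgHom_rel k (Rel.comm_of_ne (D := D) i μ h f)
  rwa [map_sub, map_mul, map_mul, map_zero, sub_eq_zero] at this

theorem pArr_mul_pLoc_of_eq (D : Datum P b k) (i : b.support) {μ : Weight k X}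
    (h : weightAct (P.reflection i) μ = μ) (f : localAt μ) :
    pArr D i μ * pLoc D μ f =
      pLoc D (weightAct (P.reflection i) μ) (localAct (P.reflection i) μ f) * pArr D i μ +
        pLoc D μ (localBgg P i μ h f) := by
  have := RingQuot.mkAlgHom_rel k (Rel.comm_of_eq (D := D) i μ h f)
  rwa [map_sub, map_mul, map_mul, sub_eq_iff_eq_add'] at this

theorem pArr_mul_pLoc_one_of_ne (D : Datum P b k) (i : b.support) {μ ν : Weight k X}
    (h : μ ≠ ν) : pArr D i μ * pLoc D ν 1 = 0 := by
  have := RingQuot.mkAlgHom_rel k (Rel.arr_one_of_ne (D := D) i μ ν h)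
  rwa [map_mul, map_zero] at this

theorem loc_mul (D : Datum P b k) (μ : Weight k X) (f g : localAt μ) :
    loc D μ (f * g) = loc D μ f * loc D μ g := by
  rw [loc, pLoc_mul, map_mul]
  rfl

theorem loc_add (D : Datum P b k) (μ : Weight k X) (f g : localAt μ) :
    loc D μ (f + g) = loc D μ f + loc D μ g := by
  rw [loc, pLoc_add, map_add]
  rfl

theorem loc_smul (D : Datum P b k) (μ : Weight k X) (c : k) (f : localAt μ) :
    loc D μ (c • f) = c • loc D μ f := by
  rw [loc, pLoc_smul, map_smul]
  rfl

theorem toLocal_add (μ : Weight k X) (a c : PolyAlg k X) :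
    toLocal μ (a + c) = toLocal μ a + toLocal μ c := Subtype.ext (map_add _ a c)

theorem toLocal_mul (μ : Weight k X) (a c : PolyAlg k X) :
    toLocal μ (a * c) = toLocal μ a * toLocal μ c := Subtype.ext (map_mul _ a c)

theorem toLocal_one (μ : Weight k X) : toLocal μ (1 : PolyAlg k X) = 1 :=
  Subtype.ext (map_one _)

theorem toLocal_smul (μ : Weight k X) (r : k) (a : PolyAlg k X) :
    toLocal μ (r • a) = r • toLocal μ a :=
  Subtype.ext (map_smul (IsScalarTower.toAlgHom k (PolyAlg k X) (FracAlg k X)) r a)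

theorem localAct_toLocal (g : X ≃ₗ[ℤ] X) (μ : Weight k X) (a : PolyAlg k X) :
    localAct g μ (toLocal μ a) = toLocal (weightAct g μ) (polyAct g a) :=
  Subtype.ext (fracAct_algebraMap g a)

omit [Module.Free ℤ X] in
theorem bgg_one (P : RootDatum ι X Y) (i : ι) : bgg P i (1 : PolyAlg k X) = 0 := by
  rw [bgg, map_one, ← Polynomial.C_1, Polynomial.divX_C, Polynomial.eval_zero, neg_zero]

theorem fracBgg_algebraMap (P : RootDatum ι X Y) (i : ι) (a : PolyAlg k X) :
    fracBgg P i (algebraMap (PolyAlg k X) (FracAlg k X) a) =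
      algebraMap (PolyAlg k X) (FracAlg k X) (bgg P i a) := by
  simpa [bgg_one] using fracBgg_div P i a 1 one_ne_zero

theorem localBgg_toLocal (P : RootDatum ι X Y) (i : ι) {μ : Weight k X}
    (hμ : weightAct (P.reflection i) μ = μ) (a : PolyAlg k X) :
    localBgg P i μ hμ (toLocal μ a) = toLocal μ (bgg P i a) :=
  Subtype.ext (fracBgg_algebraMap P i a)

/-- The map `a ↦ a 1_λ` from polynomials to `𝓗`. -/
def polyAtHom (D : Datum P b k) (μ : Weight k X) : PolyAlg k X →ₙₐ[k] quiverHecke D where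
  toFun := polyAt D μ
  map_smul' r a := Subtype.ext <| by
    change loc D μ (toLocal μ (r • a)) = r • loc D μ (toLocal μ a)
    rw [toLocal_smul, loc_smul]
  map_zero' := Subtype.ext <| by
    change loc D μ (toLocal μ 0) = 0
    -- No defining relation mentions `0 · 1_λ`; its vanishing comes from compatibility with the
    -- scalar `0`.
    have h : toLocal μ (0 : PolyAlg k X) = (0 : k) • (1 : localAt μ) := by
      rw [zero_smul]
      exact Subtype.ext (map_zero _)
    rw [h, loc_smul, zero_smul]
  map_add' a c := Subtype.ext <| by
    change loc D μ (toLocal μ (a + c)) = loc D μ (toLocal μ a) + loc D μ (toLocal μ c)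
    rw [toLocal_add, loc_add]
  map_mul' a c := Subtype.ext <| by
    change loc D μ (toLocal μ (a * c)) = loc D μ (toLocal μ a) * loc D μ (toLocal μ c)
    rw [toLocal_mul, loc_mul]

/-- The element `r_α^λ` of `𝓗`. -/
def arrAt (D : Datum P b k) (i : b.support) (μ : Weight k X) : quiverHecke D :=
  ⟨arr D i μ, NonUnitalAlgebra.subset_adjoin k (Or.inr ⟨i, μ, rfl⟩)⟩

theorem arrAt_mul_polyAt_of_ne (D : Datum P b k) (i : b.support) {μ : Weight k X}
    (h : weightAct (P.reflection i) μ ≠ μ) (a : PolyAlg k X) :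
    arrAt D i μ * polyAt D μ a =
      polyAt D (weightAct (P.reflection i) μ) (polyAct (P.reflection i) a) * arrAt D i μ := by
  apply Subtype.ext
  have := congrArg (RingQuot.mkAlgHom k (TorsionRel D)) (pArr_mul_pLoc_of_ne D i h (toLocal μ a))
  rw [localAct_toLocal, map_mul, map_mul] at this
  exact this

theorem arrAt_mul_polyAt_of_eq (D : Datum P b k) (i : b.support) {μ : Weight k X}
    (h : weightAct (P.reflection i) μ = μ) (a : PolyAlg k X) :
    arrAt D i μ * polyAt D μ a =
      polyAt D μ (polyAct (P.reflection i) a) * arrAt D i μ + polyAt D μ (bgg P i a) := by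
  apply Subtype.ext
  have := congrArg (RingQuot.mkAlgHom k (TorsionRel D)) (pArr_mul_pLoc_of_eq D i h (toLocal μ a))
  rw [localAct_toLocal, localBgg_toLocal, map_add, map_mul, map_mul, h] at this
  exact this

theorem arrAt_mul_idem (D : Datum P b k) (i : b.support) (μ : Weight k X) :
    arrAt D i μ * idem D μ = arrAt D i μ := by
  apply Subtype.ext
  have := toUnital_eq_of_rel (D := D) (Rel.arr_one i μ)
  rw [map_mul, ← toLocal_one] at this
  exact this

theorem polyAt_mul_polyAt_of_ne (D : Datum P b k) {μ ν : Weight k X} (h : μ ≠ ν)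
    (a c : PolyAlg k X) : polyAt D μ a * polyAt D ν c = 0 :=
  Subtype.ext <| by
    have := congrArg (RingQuot.mkAlgHom k (TorsionRel D))
      (pLoc_mul_of_ne D h (toLocal μ a) (toLocal ν c))
    rw [map_mul, map_zero] at this
    exact this

end Relations

/-! ### Fractions acting on a weight space through polynomials -/

section LocalAction

variable {ι k X Y : Type*} [Field k] [AddCommGroup X] [AddCommGroup Y] [Module.Free ℤ X]
  {P : RootDatum ι X Y} {b : P.Base} {D : Datum P b k} (V : FinRep.{w} (k := k) (idem D))

/-- The action of `a 1_λ` on a representation of `𝓗`. -/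
def polyEnd (μ : Weight k X) : PolyAlg k X →ₙₐ[k] Module.End k V.carrier :=
  V.ρ.comp (polyAtHom D μ)

/-- The action of `r_α^λ` on a representation of `𝓗`. -/
def arrEnd (i : b.support) (μ : Weight k X) : Module.End k V.carrier := V.ρ (arrAt D i μ)

theorem polyEnd_apply (μ : Weight k X) (a : PolyAlg k X) :
    polyEnd V μ a = V.ρ (polyAt D μ a) := rfl

theorem polyEnd_mul_of_ne {μ ν : Weight k X} (h : μ ≠ ν) (a c : PolyAlg k X) :
    polyEnd V μ a * polyEnd V ν c = 0 := by
  rw [polyEnd_apply, polyEnd_apply, ← map_mul, polyAt_mul_polyAt_of_ne D h, map_zero]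

theorem arrEnd_mul_polyEnd_one (i : b.support) (μ : Weight k X) :
    arrEnd V i μ * polyEnd V μ 1 = arrEnd V i μ := by
  rw [polyEnd_apply, arrEnd, ← map_mul]
  exact congrArg V.ρ (arrAt_mul_idem D i μ)

theorem arrEnd_mul_polyEnd_of_ne (i : b.support) {μ : Weight k X}
    (h : weightAct (P.reflection i) μ ≠ μ) (a : PolyAlg k X) :
    arrEnd V i μ * polyEnd V μ a =
      polyEnd V (weightAct (P.reflection i) μ) (polyAct (P.reflection i) a) * arrEnd V i μ := by
  rw [polyEnd_apply, polyEnd_apply, arrEnd, ← map_mul, ← map_mul, arrAt_mul_polyAt_of_ne D i h]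

theorem arrEnd_mul_polyEnd_of_eq (i : b.support) {μ : Weight k X}
    (h : weightAct (P.reflection i) μ = μ) (a : PolyAlg k X) :
    arrEnd V i μ * polyEnd V μ a =
      polyEnd V μ (polyAct (P.reflection i) a) * arrEnd V i μ + polyEnd V μ (bgg P i a) := by
  rw [polyEnd_apply, polyEnd_apply, polyEnd_apply, arrEnd, ← map_mul, ← map_mul, ← map_add,
    arrAt_mul_polyAt_of_eq D i h]

/-- The ideal of the polynomials that act by zero on `1_λ V`. -/
def annIdeal (μ : Weight k X) : Ideal (PolyAlg k X) where
  carrier := {a | polyEnd V μ a = 0}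
  zero_mem' := map_zero _
  add_mem' {a c} (ha : _ = _) (hc : _ = _) := by
    change polyEnd V μ (a + c) = 0
    rw [map_add, ha, hc, add_zero]
  smul_mem' a c (hc : _ = _) := by
    change polyEnd V μ (a * c) = 0
    rw [map_mul, hc, mul_zero]

theorem mem_annIdeal {μ : Weight k X} {a : PolyAlg k X} :
    a ∈ annIdeal V μ ↔ polyEnd V μ a = 0 := Iff.rfl

/-- Every polynomial that does not vanish at `λ` acts invertibly on `1_λ V`. -/
def IsLocalizable : Prop :=
  ∀ (μ : Weight k X) (a : PolyAlg k X), μ a ≠ 0 → ∃ c, polyEnd V μ (a * c) = polyEnd V μ 1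

/-- Modulo the radical `J`, the quotient map and `a ↦ a(λ)` are two algebra maps `A → A / J`.
Nilpotency makes them agree on the generators `P_x`, `x ∈ S`, hence everywhere. -/
theorem sub_mem_radical_annIdeal {S : Set X}
    (hS : Submodule.span k ((fun x : X => (1 : k) ⊗ₜ[ℤ] x) '' S) = ⊤)
    (hV : IsNilpotentOn D S V) (μ : Weight k X) (a : PolyAlg k X) :
    a - algebraMap k (PolyAlg k X) (μ a) ∈ (annIdeal V μ).radical := by
  set J := (annIdeal V μ).radical
  have h : Ideal.Quotient.mkₐ k J = (Algebra.ofId k (PolyAlg k X ⧸ J)).comp μ := by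
    apply SymmetricAlgebra.algHom_ext
    apply LinearMap.ext_on hS
    rintro _ ⟨x, hx, rfl⟩
    obtain ⟨N, hN⟩ := hV μ x hx
    have hx : polyGen k x - algebraMap k (PolyAlg k X) (μ (polyGen k x)) ∈ J :=
      ⟨N, hN N le_rfl⟩
    exact (Ideal.Quotient.eq (I := J)).2 hx
  exact (Ideal.Quotient.eq (I := J)).1 (DFunLike.congr_fun h a)

/-- Modulo the annihilator of `1_λ V`, the polynomial `a` is the non-zero scalar `a(λ)` plus a
nilpotent, hence a unit. -/
theorem isLocalizable_of_isNilpotentOn {S : Set X}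
    (hS : Submodule.span k ((fun x : X => (1 : k) ⊗ₜ[ℤ] x) '' S) = ⊤)
    (hV : IsNilpotentOn D S V) : IsLocalizable V := by
  intro μ a ha
  obtain ⟨n, hn⟩ := sub_mem_radical_annIdeal V hS hV μ a
  have hu : IsUnit (Ideal.Quotient.mk (annIdeal V μ) a) := by
    have h1 : IsNilpotent (Ideal.Quotient.mk (annIdeal V μ)
        (a - algebraMap k (PolyAlg k X) (μ a))) :=
      ⟨n, by rw [← map_pow]; exact Ideal.Quotient.eq_zero_iff_mem.2 hn⟩
    have h2 : IsUnit (Ideal.Quotient.mk (annIdeal V μ) (algebraMap k (PolyAlg k X) (μ a))) :=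
      ((isUnit_iff_ne_zero.2 ha).map _).map _
    have := h1.isUnit_add_left_of_commute h2 (Commute.all _ _)
    rwa [← map_add, add_sub_cancel] at this
  obtain ⟨c, hc⟩ := hu.exists_right_inv
  obtain ⟨c, rfl⟩ := Ideal.Quotient.mk_surjective c
  rw [← map_mul, ← map_one (Ideal.Quotient.mk (annIdeal V μ)), Ideal.Quotient.eq,
    mem_annIdeal, map_sub, sub_eq_zero] at hc
  exact ⟨c, hc⟩

/-- The polynomial `p` acts on `1_λ V` as the fraction `f` has to act. -/
def Represents (μ : Weight k X) (f : FracAlg k X) (p : PolyAlg k X) : Prop :=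
  ∃ a c : PolyAlg k X, μ c ≠ 0 ∧
    f * algebraMap (PolyAlg k X) (FracAlg k X) c = algebraMap (PolyAlg k X) (FracAlg k X) a ∧
    polyEnd V μ (c * p) = polyEnd V μ a

variable {V}

theorem IsLocalizable.cancel (hV : IsLocalizable V) {μ : Weight k X} {c x y : PolyAlg k X}
    (hc : μ c ≠ 0) (h : polyEnd V μ (c * x) = polyEnd V μ (c * y)) :
    polyEnd V μ x = polyEnd V μ y := by
  obtain ⟨d, hd⟩ := hV μ c hc
  rw [← one_mul x, ← one_mul y, map_mul, map_mul _ 1 y, ← hd, ← map_mul, ← map_mul, mul_comm c,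
    mul_assoc, mul_assoc, map_mul, h, map_mul _ d]

/-- The defining identity holds for every way of writing `f c = a`, not only for the chosen one, and
even when `c` vanishes at `λ`. This is needed when the denominator is imposed by a calculation. -/
theorem Represents.polyEnd_mul_eq (hV : IsLocalizable V) {μ : Weight k X} {f : FracAlg k X}
    {p a c : PolyAlg k X} (h : Represents V μ f p)
    (hf : f * algebraMap (PolyAlg k X) (FracAlg k X) c = algebraMap (PolyAlg k X) (FracAlg k X) a) :
    polyEnd V μ (c * p) = polyEnd V μ a := by
  obtain ⟨a', c', hc', hf', hp⟩ := h
  have h1 : c * a' = c' * a := by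
    apply IsFractionRing.injective (PolyAlg k X) (FracAlg k X)
    rw [map_mul, map_mul, ← hf, ← hf']
    ring
  apply hV.cancel hc'
  rw [← h1, map_mul _ c a', ← hp, ← map_mul]
  congr 1
  ring

theorem Represents.unique (hV : IsLocalizable V) {μ : Weight k X} {f : FracAlg k X}
    {p q : PolyAlg k X} (hp : Represents V μ f p) (hq : Represents V μ f q) :
    polyEnd V μ p = polyEnd V μ q := by
  obtain ⟨a, c, hc, hf, h⟩ := hq
  exact hV.cancel hc ((hp.polyEnd_mul_eq hV hf).trans h.symm)

theorem IsLocalizable.exists_represents (hV : IsLocalizable V) {μ : Weight k X} {f : FracAlg k X}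
    (hf : f ∈ localAt μ) : ∃ p, Represents V μ f p := by
  obtain ⟨a, c, hc, rfl⟩ := hf
  obtain ⟨d, hd⟩ := hV μ c hc
  refine ⟨d * a, a, c, hc, div_mul_cancel₀ _ (algebraMap_ne_zero_of_eval hc), ?_⟩
  rw [← mul_assoc, map_mul, hd, ← map_mul, one_mul]

theorem represents_algebraMap (μ : Weight k X) (a : PolyAlg k X) :
    Represents V μ (algebraMap (PolyAlg k X) (FracAlg k X) a) a :=
  ⟨a, 1, by simp, by simp, by rw [one_mul]⟩

theorem Represents.add {μ : Weight k X} {f g : FracAlg k X} {p q : PolyAlg k X}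
    (hp : Represents V μ f p) (hq : Represents V μ g q) : Represents V μ (f + g) (p + q) := by
  obtain ⟨a, c, hc, hf, h⟩ := hp
  obtain ⟨a', c', hc', hf', h'⟩ := hq
  refine ⟨c' * a + c * a', c * c', by simp [hc, hc'], ?_, ?_⟩
  · simp only [map_add, map_mul, ← hf, ← hf']
    ring
  · rw [show c * c' * (p + q) = c' * (c * p) + c * (c' * q) by ring]
    simp only [map_add, map_mul _ c', map_mul _ c (_ * _), map_mul _ c a', h]
    rw [← h', map_mul _ c' q]

theorem Represents.mul {μ : Weight k X} {f g : FracAlg k X} {p q : PolyAlg k X}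
    (hp : Represents V μ f p) (hq : Represents V μ g q) : Represents V μ (f * g) (p * q) := by
  obtain ⟨a, c, hc, hf, h⟩ := hp
  obtain ⟨a', c', hc', hf', h'⟩ := hq
  refine ⟨a * a', c * c', by simp [hc, hc'], ?_, ?_⟩
  · simp only [map_mul, ← hf, ← hf']
    ring
  · rw [show c * c' * (p * q) = (c * p) * (c' * q) by ring, map_mul, h, h', ← map_mul]

theorem Represents.smul {μ : Weight k X} {f : FracAlg k X} {p : PolyAlg k X} (r : k)
    (hp : Represents V μ f p) : Represents V μ (r • f) (r • p) := by
  obtain ⟨a, c, hc, hf, h⟩ := hp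
  refine ⟨r • a, c, hc, ?_, ?_⟩
  · rw [smul_mul_assoc, hf]
    exact (map_smul (IsScalarTower.toAlgHom k (PolyAlg k X) (FracAlg k X)) r a).symm
  · rw [mul_smul_comm, map_smul, map_smul, h]

theorem IsLocalizable.cancel_right (hV : IsLocalizable V) {μ : Weight k X} {c : PolyAlg k X}
    (hc : μ c ≠ 0) {M N : Module.End k V.carrier} (hM : M * polyEnd V μ 1 = M)
    (hN : N * polyEnd V μ 1 = N) (h : M * polyEnd V μ c = N * polyEnd V μ c) : M = N := by
  obtain ⟨d, hd⟩ := hV μ c hc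
  rw [← hM, ← hN, ← hd, map_mul, ← mul_assoc, ← mul_assoc, h]

theorem polyEnd_mul_one (μ : Weight k X) (a : PolyAlg k X) :
    polyEnd V μ a * polyEnd V μ 1 = polyEnd V μ a := by
  rw [← map_mul, mul_one]

/-- After right multiplication by a denominator `c` of `f`, both sides follow from the polynomial
commutation relation; then `c` is cancelled. -/
theorem Represents.arrEnd_mul_of_ne (hV : IsLocalizable V) (i : b.support) {μ : Weight k X}
    (hμ : weightAct (P.reflection i) μ ≠ μ) {f : FracAlg k X} {p q : PolyAlg k X}
    (hp : Represents V μ f p)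
    (hq : Represents V (weightAct (P.reflection i) μ) (fracAct (P.reflection i) f) q) :
    arrEnd V i μ * polyEnd V μ p =
      polyEnd V (weightAct (P.reflection i) μ) q * arrEnd V i μ := by
  obtain ⟨a, c, hc, hf, h⟩ := hp
  have hf' := congrArg (fracAct (P.reflection i)) hf
  rw [map_mul, fracAct_algebraMap, fracAct_algebraMap] at hf'
  have h' := hq.polyEnd_mul_eq hV hf'
  refine hV.cancel_right hc ?_ ?_ ?_
  · rw [mul_assoc, polyEnd_mul_one]
  · rw [mul_assoc, arrEnd_mul_polyEnd_one]
  · rw [mul_assoc, ← map_mul, mul_comm p, h, arrEnd_mul_polyEnd_of_ne V i hμ, mul_assoc,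
      arrEnd_mul_polyEnd_of_ne V i hμ, ← h', mul_comm _ q, map_mul, mul_assoc]

/-- Again a denominator `c` is cancelled on the right. The extra terms match by the twisted Leibniz
rule applied to `f c = a`: `Δ(f) c + s(f) Δ(c) = Δ(a)`. -/
theorem Represents.arrEnd_mul_of_eq (hV : IsLocalizable V) (i : b.support) {μ : Weight k X}
    (hμ : weightAct (P.reflection i) μ = μ) {f : FracAlg k X} {p q d : PolyAlg k X}
    (hp : Represents V μ f p) (hq : Represents V μ (fracAct (P.reflection i) f) q)
    (hd : Represents V μ (fracBgg P i f) d) :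
    arrEnd V i μ * polyEnd V μ p = polyEnd V μ q * arrEnd V i μ + polyEnd V μ d := by
  obtain ⟨a, c, hc, hf, h⟩ := hp
  have hc' := algebraMap_ne_zero_of_eval hc
  have hf' := congrArg (fracAct (P.reflection i)) hf
  rw [map_mul, fracAct_algebraMap, fracAct_algebraMap] at hf'
  have h' := hq.polyEnd_mul_eq hV hf'
  have hfd : fracBgg P i f * algebraMap (PolyAlg k X) (FracAlg k X) c +
      fracAct (P.reflection i) f * algebraMap (PolyAlg k X) (FracAlg k X) (bgg P i c) =
        algebraMap (PolyAlg k X) (FracAlg k X) (bgg P i a) := by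
    have hc0 : c ≠ 0 := by
      rintro rfl
      simp at hc
    have := fracBgg_div P i a c hc0
    rw [← eq_div_of_mul_eq hc' hf] at this
    rw [this, div_mul_cancel₀ _ hc', sub_add_cancel]
  have hd' :=
    (hd.mul (represents_algebraMap μ c)).add (hq.mul (represents_algebraMap μ (bgg P i c)))
  rw [hfd] at hd'
  have h2 := hd'.unique hV (represents_algebraMap μ _)
  refine hV.cancel_right hc ?_ ?_ ?_
  · rw [mul_assoc, polyEnd_mul_one]
  · rw [add_mul, mul_assoc, arrEnd_mul_polyEnd_one, polyEnd_mul_one]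
  · rw [mul_assoc, ← map_mul, mul_comm p, h, arrEnd_mul_polyEnd_of_eq V i hμ, add_mul, mul_assoc,
      arrEnd_mul_polyEnd_of_eq V i hμ, ← h', mul_comm _ q, ← h2]
    simp only [map_mul, map_add, mul_add, mul_assoc]
    abel

end LocalAction

/-! ### Extending the action from `𝓗` to the localized algebra -/

section Extension

variable {ι k X Y : Type*} [Field k] [AddCommGroup X] [AddCommGroup Y] [Module.Free ℤ X]
  {P : RootDatum ι X Y} {b : P.Base} {D : Datum P b k} {V : FinRep.{w} (k := k) (idem D)}

/-- The polynomial by which a fraction `f` acts on `1_λ V`. -/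
def IsLocalizable.poly (hV : IsLocalizable V) (μ : Weight k X) (f : localAt μ) : PolyAlg k X :=
  (hV.exists_represents f.2).choose

theorem IsLocalizable.represents_poly (hV : IsLocalizable V) (μ : Weight k X) (f : localAt μ) :
    Represents V μ f (hV.poly μ f) :=
  (hV.exists_represents f.2).choose_spec

/-- The action of the generators of the localized algebra on a localizable representation. -/
def IsLocalizable.genEnd (hV : IsLocalizable V) : Gen k b → Module.End k V.carrier
  | .loc μ f => polyEnd V μ (hV.poly μ f)
  | .arr i μ => arrEnd V i μ

/-- The action of the free algebra on a localizable representation. -/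
def IsLocalizable.freeEnd (hV : IsLocalizable V) :
    FreeAlgebra k (Gen k b) →ₐ[k] Module.End k V.carrier :=
  FreeAlgebra.lift k hV.genEnd

theorem IsLocalizable.freeEnd_fArr (hV : IsLocalizable V) (i : b.support) (μ : Weight k X) :
    hV.freeEnd (fArr b i μ) = arrEnd V i μ :=
  FreeAlgebra.lift_ι_apply _ _

theorem IsLocalizable.freeEnd_fLoc (hV : IsLocalizable V) {μ : Weight k X} {f : localAt μ}
    {p : PolyAlg k X} (h : Represents V μ f p) : hV.freeEnd (fLoc b μ f) = polyEnd V μ p :=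
  (FreeAlgebra.lift_ι_apply _ _).trans ((hV.represents_poly μ f).unique hV h)

theorem represents_toLocal (μ : Weight k X) (a : PolyAlg k X) :
    Represents V μ (toLocal μ a : localAt μ) a :=
  represents_algebraMap μ a

/-- The actions `φ` of an algebra over the localized algebra `π` and `ρ` of `𝓗` agree on `x`. -/
def Agrees {R : Type*} [Ring R] [Algebra k R] (π : R →ₐ[k] UnitalHecke D)
    (φ : R →ₐ[k] Module.End k V.carrier) (x : R) : Prop :=
  ∃ y : quiverHecke D, (y : UnitalHecke D) = π x ∧ φ x = V.ρ y

namespace Agrees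

variable {R : Type*} [Ring R] [Algebra k R] {π : R →ₐ[k] UnitalHecke D}
  {φ : R →ₐ[k] Module.End k V.carrier} {x y : R}

theorem zero : Agrees π φ (0 : R) := ⟨0, by simp, by simp⟩

theorem add (hx : Agrees π φ x) (hy : Agrees π φ y) : Agrees π φ (x + y) := by
  obtain ⟨u, hu, hu'⟩ := hx
  obtain ⟨v, hv, hv'⟩ := hy
  exact ⟨u + v, by rw [map_add, ← hu, ← hv]; rfl, by rw [map_add, map_add, hu', hv']⟩

theorem mul (hx : Agrees π φ x) (hy : Agrees π φ y) : Agrees π φ (x * y) := by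
  obtain ⟨u, hu, hu'⟩ := hx
  obtain ⟨v, hv, hv'⟩ := hy
  exact ⟨u * v, by rw [map_mul, ← hu, ← hv]; rfl, by rw [map_mul, map_mul, hu', hv']⟩

theorem smul (r : k) (hx : Agrees π φ x) : Agrees π φ (r • x) := by
  obtain ⟨u, hu, hu'⟩ := hx
  exact ⟨r • u, by rw [map_smul, ← hu]; rfl, by rw [map_smul, map_smul, hu']⟩

/-- An element of `𝓗` is determined by its image in the unitization, so elements with equal images
there act through the same operator `V.ρ y`. This transfers relations to `V` without computation. -/
theorem congr (hx : Agrees π φ x) (hy : Agrees π φ y) (h : π x = π y) : φ x = φ y := by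
  obtain ⟨u, hu, hu'⟩ := hx
  obtain ⟨v, hv, hv'⟩ := hy
  rw [hu', hv', Subtype.ext (hu.trans (h.trans hv.symm))]

end Agrees

theorem IsLocalizable.agrees_fLoc (hV : IsLocalizable V) (μ : Weight k X) (a : PolyAlg k X) :
    Agrees (toUnital D) hV.freeEnd (fLoc b μ (toLocal μ a)) :=
  ⟨polyAt D μ a, rfl, hV.freeEnd_fLoc (represents_toLocal μ a)⟩

theorem IsLocalizable.agrees_fLoc_one (hV : IsLocalizable V) (μ : Weight k X) :
    Agrees (toUnital D) hV.freeEnd (fLoc b μ 1) := by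
  rw [← toLocal_one]
  exact hV.agrees_fLoc μ 1

theorem IsLocalizable.agrees_fArr (hV : IsLocalizable V) (i : b.support) (μ : Weight k X) :
    Agrees (toUnital D) hV.freeEnd (fArr b i μ) :=
  ⟨arrAt D i μ, rfl, hV.freeEnd_fArr i μ⟩

theorem IsLocalizable.agrees_fWord (hV : IsLocalizable V) (l : List b.support)
    (μ : Weight k X) : Agrees (toUnital D) hV.freeEnd (fWord b l μ) := by
  induction l generalizing μ with
  | nil => exact hV.agrees_fLoc_one μ
  | cons i l ih => exact (ih _).mul (hV.agrees_fArr i μ)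

theorem IsLocalizable.freeEnd_rel (hV : IsLocalizable V) (hD : D.IsPolynomial)
    {x y : FreeAlgebra k (Gen k b)} (h : Rel D x y) : hV.freeEnd x = hV.freeEnd y := by
  have hxy := toUnital_eq_of_rel h
  cases h with
  | loc_add μ f g =>
    rw [map_add, hV.freeEnd_fLoc (hV.represents_poly μ f),
      hV.freeEnd_fLoc (hV.represents_poly μ g), ← map_add]
    exact hV.freeEnd_fLoc ((hV.represents_poly μ f).add (hV.represents_poly μ g))
  | loc_smul μ c f =>
    rw [map_smul, hV.freeEnd_fLoc (hV.represents_poly μ f), ← map_smul]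
    exact hV.freeEnd_fLoc ((hV.represents_poly μ f).smul c)
  | loc_mul μ f g =>
    rw [map_mul, hV.freeEnd_fLoc (hV.represents_poly μ f),
      hV.freeEnd_fLoc (hV.represents_poly μ g), ← map_mul]
    exact (hV.freeEnd_fLoc ((hV.represents_poly μ f).mul (hV.represents_poly μ g))).symm
  | loc_mul_of_ne μ ν f g h =>
    rw [map_mul, hV.freeEnd_fLoc (hV.represents_poly μ f),
      hV.freeEnd_fLoc (hV.represents_poly ν g), polyEnd_mul_of_ne V h, map_zero]
  | arr_one i μ =>
    exact ((hV.agrees_fArr i μ).mul (hV.agrees_fLoc_one μ)).congr (hV.agrees_fArr i μ) hxy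
  | arr_one_of_ne i μ ν h =>
    exact ((hV.agrees_fArr i μ).mul (hV.agrees_fLoc_one ν)).congr .zero hxy
  | one_arr i μ =>
    exact ((hV.agrees_fLoc_one _).mul (hV.agrees_fArr i μ)).congr (hV.agrees_fArr i μ) hxy
  | one_arr_of_ne i μ ν h =>
    exact ((hV.agrees_fLoc_one _).mul (hV.agrees_fArr i μ)).congr .zero hxy
  | quad_of_ne i μ h =>
    obtain ⟨a, ha⟩ := hD i μ
    -- Polynomiality of `H_α^λ` puts the right-hand side in `𝓗`, so the relation is inherited.
    have hG : (⟨D.G i μ, D.mem_localAt i μ⟩ : localAt μ) = toLocal μ a := Subtype.ext ha.symm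
    rw [hG] at hxy ⊢
    exact ((hV.agrees_fArr i _).mul (hV.agrees_fArr i μ)).congr (hV.agrees_fLoc μ a) hxy
  | quad_of_eq i μ h =>
    exact ((hV.agrees_fArr i _).mul (hV.agrees_fArr i μ)).congr .zero hxy
  | comm_of_ne i μ h f =>
    rw [map_sub, map_mul, map_mul, map_zero, sub_eq_zero, hV.freeEnd_fArr,
      hV.freeEnd_fLoc (hV.represents_poly μ f), hV.freeEnd_fLoc (hV.represents_poly _ _)]
    have h1 : Represents V (weightAct (P.reflection i) μ) (fracAct (P.reflection i) f)
        (hV.poly _ (localAct (P.reflection i) μ f)) :=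
      hV.represents_poly _ (localAct (P.reflection i) μ f)
    exact (hV.represents_poly μ f).arrEnd_mul_of_ne hV i h h1
  | comm_of_eq i μ h f =>
    rw [map_sub, map_mul, map_mul, sub_eq_iff_eq_add', hV.freeEnd_fArr,
      hV.freeEnd_fLoc (hV.represents_poly μ f), hV.freeEnd_fLoc (hV.represents_poly _ _),
      hV.freeEnd_fLoc (hV.represents_poly _ _)]
    have h1 : Represents V (weightAct (P.reflection i) μ) (fracAct (P.reflection i) f)
        (hV.poly _ (localAct (P.reflection i) μ f)) :=
      hV.represents_poly _ (localAct (P.reflection i) μ f)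
    -- The chosen polynomial depends on the weight `s_α(λ)`; it is made a variable so that `s_α(λ) =
    -- λ` can be rewritten.
    generalize hV.poly _ (localAct (P.reflection i) μ f) = q at h1 ⊢
    rw [h] at h1 ⊢
    exact (hV.represents_poly μ f).arrEnd_mul_of_eq hV i h h1
      (hV.represents_poly μ (localBgg P i μ h f))
  | braid i j hij μ h => exact (hV.agrees_fWord _ μ).congr (hV.agrees_fWord _ μ) hxy

/-- The action of the algebra before torsion is divided out. -/
def IsLocalizable.preEnd (hV : IsLocalizable V) (hD : D.IsPolynomial) :
    PreHecke D →ₐ[k] Module.End k V.carrier :=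
  RingQuot.liftAlgHom k ⟨hV.freeEnd, fun _ _ h => hV.freeEnd_rel hD h⟩

theorem IsLocalizable.preEnd_mk (hV : IsLocalizable V) (hD : D.IsPolynomial)
    (x : FreeAlgebra k (Gen k b)) :
    hV.preEnd hD (RingQuot.mkAlgHom k (Rel D) x) = hV.freeEnd x :=
  RingQuot.liftAlgHom_mkAlgHom_apply _ _ _ _

theorem IsLocalizable.agrees_mk (hV : IsLocalizable V) (hD : D.IsPolynomial)
    {x : FreeAlgebra k (Gen k b)} (hx : Agrees (toUnital D) hV.freeEnd x) :
    Agrees (RingQuot.mkAlgHom k (TorsionRel D)) (hV.preEnd hD)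
      (RingQuot.mkAlgHom k (Rel D) x) := by
  obtain ⟨y, hy, hy'⟩ := hx
  exact ⟨y, hy, (hV.preEnd_mk hD x).trans hy'⟩

/-- For each weight `λ`, some polynomial multiple of `x 1_λ` comes from `𝓗`, where the polynomial
does not vanish at `λ`. -/
def HasDenominators (hV : IsLocalizable V) (hD : D.IsPolynomial) (x : PreHecke D) : Prop :=
  ∀ μ : Weight k X, ∃ c : PolyAlg k X, μ c ≠ 0 ∧
    Agrees (RingQuot.mkAlgHom k (TorsionRel D)) (hV.preEnd hD) (x * pLoc D μ (toLocal μ c))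

namespace HasDenominators

variable {hV : IsLocalizable V} {hD : D.IsPolynomial} {x y : PreHecke D}

theorem one : HasDenominators hV hD (1 : PreHecke D) := fun μ =>
  ⟨1, by simp, by
    rw [one_mul]
    exact hV.agrees_mk hD (hV.agrees_fLoc μ 1)⟩

theorem add (hx : HasDenominators hV hD x) (hy : HasDenominators hV hD y) :
    HasDenominators hV hD (x + y) := fun μ => by
  obtain ⟨c, hc, h⟩ := hx μ
  obtain ⟨d, hd, h'⟩ := hy μ
  refine ⟨c * d, by simp [hc, hd], ?_⟩
  rw [add_mul]
  refine .add ?_ ?_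
  · rw [toLocal_mul, pLoc_mul, ← mul_assoc]
    exact h.mul (hV.agrees_mk hD (hV.agrees_fLoc μ d))
  · rw [mul_comm, toLocal_mul, pLoc_mul, ← mul_assoc]
    exact h'.mul (hV.agrees_mk hD (hV.agrees_fLoc μ c))

theorem smul (r : k) (hx : HasDenominators hV hD x) : HasDenominators hV hD (r • x) := fun μ => by
  obtain ⟨c, hc, h⟩ := hx μ
  exact ⟨c, hc, by rw [smul_mul_assoc]; exact h.smul r⟩

/-- If `c` works for `x` at `ν` and `f = a / d`, then `x f (c d) = (x c) a`, so `c d` works. -/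
theorem mul_pLoc (hx : HasDenominators hV hD x) (ν : Weight k X) (f : localAt ν) :
    HasDenominators hV hD (x * pLoc D ν f) := fun μ => by
  by_cases hμ : ν = μ
  · subst hμ
    obtain ⟨c, hc, h⟩ := hx ν
    obtain ⟨a, d, hd, hf⟩ := f.2
    refine ⟨c * d, by simp [hc, hd], ?_⟩
    have : f * toLocal ν (c * d) = toLocal ν c * toLocal ν a := by
      apply Subtype.ext
      change (f : FracAlg k X) * algebraMap _ _ (c * d) = algebraMap _ _ c * algebraMap _ _ a
      have hd' := algebraMap_ne_zero_of_eval hd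
      rw [hf, map_mul]
      field_simp
    rw [mul_assoc, ← pLoc_mul, this, pLoc_mul, ← mul_assoc]
    exact h.mul (hV.agrees_mk hD (hV.agrees_fLoc ν a))
  · exact ⟨1, by simp, by rw [mul_assoc, pLoc_mul_of_ne D hμ, mul_zero]; exact .zero⟩

/-- A denominator to the right of `r_α^ν` is moved to its left, where it must become a multiple of a
denominator `c` of `x` at `s_α(ν)`. -/
theorem mul_pArr (hx : HasDenominators hV hD x) (i : b.support) (ν : Weight k X) :
    HasDenominators hV hD (x * pArr D i ν) := fun μ => by
  by_cases hμ : ν = μ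
  · subst hμ
    obtain ⟨c, hc, h⟩ := hx (weightAct (P.reflection i) ν)
    obtain ⟨d, rfl⟩ := (polyAct (P.reflection i)).surjective c
    rw [weightAct_polyAct] at hc
    by_cases hν : weightAct (P.reflection i) ν = ν
    · rw [hν] at h
      -- With `c = s(d)`, the denominator `d` alone would leave the term `Δ(d)`, not divisible by
      -- `c` in general. For `s(d) d`, both `s(s(d) d)` and `Δ(s(d) d) = Δ(s(d)) s(d) + s(d) Δ(d)`
      -- are multiples of `c`.
      refine ⟨polyAct (P.reflection i) d * d, ?_, ?_⟩
      · have := weightAct_polyAct (P.reflection i) ν d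
        rw [hν] at this
        simp [this, hc]
      · rw [mul_assoc, pArr_mul_pLoc_of_eq D i hν, localAct_toLocal, localBgg_toLocal, hν,
          bgg_mul, map_mul, mul_comm (bgg P i _), ← mul_add, mul_comm (polyAct _ (polyAct _ d)),
          toLocal_mul, toLocal_mul, pLoc_mul, pLoc_mul, mul_assoc, ← mul_add, ← mul_assoc]
        exact h.mul (((hV.agrees_mk hD (hV.agrees_fLoc ν _)).mul
          (hV.agrees_mk hD (hV.agrees_fArr i ν))).add (hV.agrees_mk hD (hV.agrees_fLoc ν _)))
    · refine ⟨d, hc, ?_⟩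
      rw [mul_assoc, pArr_mul_pLoc_of_ne D i hν, localAct_toLocal, ← mul_assoc]
      exact h.mul (hV.agrees_mk hD (hV.agrees_fArr i ν))
  · exact ⟨1, by simp, by
      rw [mul_assoc, toLocal_one, pArr_mul_pLoc_one_of_ne D i hμ, mul_zero]; exact .zero⟩

/-- The left factor `x` stays arbitrary in the induction, so that a product is absorbed one factor
at a time: `x (z z') = (x z) z'`. -/
theorem mul_mk (hx : HasDenominators hV hD x) (z : FreeAlgebra k (Gen k b)) :
    HasDenominators hV hD (x * RingQuot.mkAlgHom k (Rel D) z) := by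
  induction z using FreeAlgebra.induction generalizing x with
  | grade0 r =>
    rw [AlgHom.commutes, ← Algebra.commutes, ← Algebra.smul_def]
    exact hx.smul r
  | grade1 g =>
    cases g with
    | loc μ f => exact hx.mul_pLoc μ f
    | arr i μ => exact hx.mul_pArr i μ
  | mul z z' h h' =>
    rw [map_mul, ← mul_assoc]
    exact h' (h hx)
  | add z z' h h' =>
    rw [map_add, mul_add]
    exact (h hx).add (h' hx)

end HasDenominators

theorem hasDenominators (hV : IsLocalizable V) (hD : D.IsPolynomial) (x : PreHecke D) :
    HasDenominators hV hD x := by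
  obtain ⟨z, rfl⟩ := RingQuot.mkAlgHom_surjective k (Rel D) x
  simpa using HasDenominators.one.mul_mk z

theorem IsLocalizable.preEnd_torsionRel (hV : IsLocalizable V) (hD : D.IsPolynomial)
    {x y : PreHecke D} (h : TorsionRel D x y) : hV.preEnd hD x = hV.preEnd hD y := by
  have hxy := RingQuot.mkAlgHom_rel k h
  cases h with
  | torsion μ I hI f hf hIf =>
    obtain ⟨c, hc, h⟩ := hasDenominators hV hD x μ
    -- `I c 1_λ` comes from `𝓗` and dies in the quotient, so it acts as the zero of `𝓗`. The
    -- polynomial `c` replaces the given torsion witness `f`, which may vanish at `λ`.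
    have key := h.congr .zero (by rw [map_mul, hxy, map_zero, zero_mul])
    have hp : ∀ a, hV.preEnd hD (pLoc D μ (toLocal μ a)) = polyEnd V μ a := fun a =>
      (hV.preEnd_mk hD _).trans (hV.freeEnd_fLoc (represents_toLocal μ a))
    rw [← toLocal_one] at hI
    have hI' := congrArg (hV.preEnd hD) hI
    rw [map_mul, hp] at hI'
    rw [map_mul, map_zero, hp] at key
    rw [map_zero]
    exact hV.cancel_right hc hI' (zero_mul _) (key.trans (zero_mul _).symm)

/-- The action of the unitization of the localized algebra. -/
def IsLocalizable.unitalEnd (hV : IsLocalizable V) (hD : D.IsPolynomial) :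
    UnitalHecke D →ₐ[k] Module.End k V.carrier :=
  RingQuot.liftAlgHom k ⟨hV.preEnd hD, fun _ _ h => hV.preEnd_torsionRel hD h⟩

theorem IsLocalizable.unitalEnd_toUnital (hV : IsLocalizable V) (hD : D.IsPolynomial)
    (x : FreeAlgebra k (Gen k b)) : hV.unitalEnd hD (toUnital D x) = hV.freeEnd x :=
  (RingQuot.liftAlgHom_mkAlgHom_apply _ _ _ _).trans (hV.preEnd_mk hD x)

theorem IsLocalizable.unitalEnd_coe (hV : IsLocalizable V) (hD : D.IsPolynomial)
    (x : quiverHecke D) : hV.unitalEnd hD x = V.ρ x := by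
  obtain ⟨x, hx⟩ := x
  induction hx using NonUnitalAlgebra.adjoin_induction with
  | mem x hx =>
    obtain ⟨μ, a, rfl⟩ | ⟨i, μ, rfl⟩ := hx
    · exact (hV.unitalEnd_toUnital hD _).trans (hV.freeEnd_fLoc (represents_toLocal μ a))
    · exact (hV.unitalEnd_toUnital hD _).trans (hV.freeEnd_fArr i μ)
  | add x y hx hy h h' =>
    exact (map_add _ x y).trans ((congrArg₂ _ h h').trans (map_add V.ρ _ _).symm)
  | zero => exact (map_zero _).trans (map_zero V.ρ).symm
  | mul x y hx hy h h' =>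
    exact (map_mul _ x y).trans ((congrArg₂ _ h h').trans (map_mul V.ρ _ _).symm)
  | smul r x hx h =>
    exact (map_smul _ r x).trans ((congrArg _ h).trans (map_smul V.ρ r ⟨x, hx⟩).symm)

/-- The action of the localized algebra on a localizable representation of `𝓗`. -/
def IsLocalizable.localizedAction (hV : IsLocalizable V) (hD : D.IsPolynomial) :
    localizedHecke D →ₙₐ[k] Module.End k V.carrier :=
  (hV.unitalEnd hD : UnitalHecke D →ₙₐ[k] Module.End k V.carrier).comp
    (NonUnitalSubalgebraClass.subtype (localizedHecke D))

theorem IsLocalizable.localizedAction_apply (hV : IsLocalizable V) (hD : D.IsPolynomial)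
    (x : localizedHecke D) : hV.localizedAction hD x = hV.unitalEnd hD (x : UnitalHecke D) := rfl

theorem coe_quiverHeckeIncl (x : quiverHecke D) :
    (quiverHeckeIncl D x : UnitalHecke D) = (x : UnitalHecke D) :=
  NonUnitalSubalgebra.coe_inclusion (quiverHecke_le D) x

theorem IsLocalizable.localizedAction_incl (hV : IsLocalizable V) (hD : D.IsPolynomial)
    (x : quiverHecke D) : hV.localizedAction hD (quiverHeckeIncl D x) = V.ρ x := by
  rw [hV.localizedAction_apply, coe_quiverHeckeIncl, hV.unitalEnd_coe]

end Extension

/-! ### Pullback of finite representations along a general morphism -/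

section FinRep

variable {T k B C : Type*} [Field k] [NonUnitalSemiring B] [Module k B] [NonUnitalSemiring C]
  [Module k C] {e : T → B} {e' : T → C}

theorem FinRep.pullback_faithful (φ : B →ₙₐ[k] C) (h : ∀ t, φ (e t) = e' t) :
    (FinRep.pullback.{w} φ h).Faithful where
  map_injective {V W f g} hfg := by
    have : ((FinRep.pullback φ h).map f).toLin = ((FinRep.pullback φ h).map g).toLin :=
      congrArg FinRep.Hom.toLin hfg
    exact FinRep.Hom.ext this

theorem FinRep.pullback_full (φ : B →ₙₐ[k] C) (h : ∀ t, φ (e t) = e' t)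
    (H : ∀ (V W : FinRep.{w} (k := k) e') (f : V.carrier →ₗ[k] W.carrier),
      (∀ x v, f (V.ρ (φ x) v) = W.ρ (φ x) (f v)) → ∀ y v, f (V.ρ y v) = W.ρ y (f v)) :
    (FinRep.pullback.{w} φ h).Full where
  map_surjective {V W} f :=
    ⟨⟨f.toLin, fun y => LinearMap.ext
      (H V W f.toLin (fun x v => LinearMap.congr_fun (f.comm x) v) y)⟩, rfl⟩

/-- The representation of `C` on the space of a representation of `B` given by an action of `C`
with the same idempotents. -/
def FinRep.ofAction (V : FinRep.{w} (k := k) e) (ψ : C →ₙₐ[k] Module.End k V.carrier)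
    (hψ : ∀ t, ψ (e' t) = V.ρ (e t)) : FinRep.{w} (k := k) e' where
  carrier := V.carrier
  ρ := ψ
  iSup_range := by simpa only [hψ] using V.iSup_range

/-- Pulling back an action that extends `V.ρ` gives back `V`. -/
def FinRep.pullbackOfActionIso (φ : B →ₙₐ[k] C) (h : ∀ t, φ (e t) = e' t)
    (V : FinRep.{w} (k := k) e) (ψ : C →ₙₐ[k] Module.End k V.carrier)
    (hψ : ∀ t, ψ (e' t) = V.ρ (e t)) (hφ : ∀ x, ψ (φ x) = V.ρ x) :
    (FinRep.pullback φ h).obj (V.ofAction ψ hψ) ≅ V where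
  hom := ⟨LinearMap.id, hφ⟩
  inv := ⟨LinearMap.id, fun x => (hφ x).symm⟩
  hom_inv_id := FinRep.Hom.ext rfl
  inv_hom_id := FinRep.Hom.ext rfl

theorem FinRep.pullback_ρ_eq_zero_of_mul (φ : B →ₙₐ[k] C) (h : ∀ t, φ (e t) = e' t)
    (V : FinRep.{w} (k := k) e') {x y : B} {z : C} (hz : φ y * z = φ x)
    (hy : ((FinRep.pullback φ h).obj V).ρ y = 0) : ((FinRep.pullback φ h).obj V).ρ x = 0 := by
  change V.ρ (φ y) = 0 at hy
  change V.ρ (φ x) = 0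
  rw [← hz, map_mul, hy, zero_mul]

theorem FinRep.commutes_zero {V W : FinRep.{w} (k := k) e} (f : V.carrier →ₗ[k] W.carrier)
    (v : V.carrier) : f (V.ρ 0 v) = W.ρ 0 (f v) := by
  simp

theorem FinRep.commutes_add {V W : FinRep.{w} (k := k) e} {f : V.carrier →ₗ[k] W.carrier}
    {x y : B} (hx : ∀ v, f (V.ρ x v) = W.ρ x (f v)) (hy : ∀ v, f (V.ρ y v) = W.ρ y (f v))
    (v : V.carrier) : f (V.ρ (x + y) v) = W.ρ (x + y) (f v) := by
  simp [hx, hy]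

theorem FinRep.commutes_mul {V W : FinRep.{w} (k := k) e} {f : V.carrier →ₗ[k] W.carrier}
    {x y : B} (hx : ∀ v, f (V.ρ x v) = W.ρ x (f v)) (hy : ∀ v, f (V.ρ y v) = W.ρ y (f v))
    (v : V.carrier) : f (V.ρ (x * y) v) = W.ρ (x * y) (f v) := by
  simp [hx, hy]

theorem FinRep.commutes_smul {V W : FinRep.{w} (k := k) e} {f : V.carrier →ₗ[k] W.carrier}
    (r : k) {x : B} (hx : ∀ v, f (V.ρ x v) = W.ρ x (f v))
    (v : V.carrier) : f (V.ρ (r • x) v) = W.ρ (r • x) (f v) := by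
  simp [hx]

end FinRep

/-! ### Full faithfulness, nilpotency of pullbacks and the equivalence -/

section Pullback

variable {ι k X Y : Type*} [Field k] [AddCommGroup X] [AddCommGroup Y] [Module.Free ℤ X]
  {P : RootDatum ι X Y} {b : P.Base} {D : Datum P b k}

/-- The element `f 1_λ` of the localized algebra. -/
def locAt (D : Datum P b k) (μ : Weight k X) (f : localAt μ) : localizedHecke D :=
  ⟨loc D μ f, NonUnitalAlgebra.subset_adjoin k (Or.inl ⟨μ, f, rfl⟩)⟩

theorem locAt_mul (D : Datum P b k) (μ : Weight k X) (f g : localAt μ) :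
    locAt D μ (f * g) = locAt D μ f * locAt D μ g :=
  Subtype.ext (loc_mul D μ f g)

theorem localizedHecke_induction {p : localizedHecke D → Prop}
    (loc : ∀ μ f, p (locAt D μ f)) (arr : ∀ i μ, p (quiverHeckeIncl D (arrAt D i μ)))
    (add : ∀ x y, p x → p y → p (x + y)) (zero : p 0)
    (mul : ∀ x y, p x → p y → p (x * y)) (smul : ∀ (r : k) x, p x → p (r • x))
    (x : localizedHecke D) : p x := by
  obtain ⟨x, hx⟩ := x
  refine NonUnitalAlgebra.adjoin_induction (p := fun x hx => p ⟨x, hx⟩) ?_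
    (fun x y hx hy => add ⟨x, hx⟩ ⟨y, hy⟩) zero (fun x y hx hy => mul ⟨x, hx⟩ ⟨y, hy⟩)
    (fun r x hx => smul r ⟨x, hx⟩) hx
  rintro _ (⟨μ, f, rfl⟩ | ⟨i, μ, rfl⟩)
  · exact loc μ f
  · exact arr i μ

theorem exists_toLocal_mul_eq_one {μ : Weight k X} {c : PolyAlg k X} (hc : μ c ≠ 0) :
    ∃ g : localAt μ, toLocal μ c * g = 1 :=
  ⟨⟨1 / algebraMap _ _ c, 1, c, hc, by rw [map_one]⟩,
    Subtype.ext (mul_one_div_cancel (algebraMap_ne_zero_of_eval hc))⟩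

theorem exists_eq_mul_toLocal (μ : Weight k X) (f : localAt μ) :
    ∃ (a c : PolyAlg k X) (g : localAt μ), toLocal μ c * g = 1 ∧ f = g * toLocal μ a := by
  obtain ⟨a, c, hc, hf⟩ := f.2
  obtain ⟨g, hg⟩ := exists_toLocal_mul_eq_one hc
  refine ⟨a, c, g, hg, ?_⟩
  have hfc : f * toLocal μ c = toLocal μ a :=
    Subtype.ext <| (congrArg (· * _) hf).trans (div_mul_cancel₀ _ (algebraMap_ne_zero_of_eval hc))
  rw [← hfc, mul_left_comm, mul_comm g, hg, mul_one]

/-- A linear map that commutes with the action of `𝓗` commutes with that of the localized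
algebra. -/
theorem commutes_of_commutes_quiverHecke {V W : FinRep.{w} (k := k) (localizedIdem D)}
    {T : V.carrier →ₗ[k] W.carrier}
    (hT : ∀ x v, T (V.ρ (quiverHeckeIncl D x) v) = W.ρ (quiverHeckeIncl D x) (T v))
    (x : localizedHecke D) : ∀ v, T (V.ρ x v) = W.ρ x (T v) := by
  induction x using localizedHecke_induction with
  | loc μ f =>
    have hpoly (a : PolyAlg k X) : ∀ v, T (V.ρ (locAt D μ (toLocal μ a)) v) =
        W.ρ (locAt D μ (toLocal μ a)) (T v) := hT (polyAt D μ a)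
    have hone := hpoly 1
    rw [toLocal_one] at hone
    obtain ⟨a, c, g, hg, rfl⟩ := exists_eq_mul_toLocal μ f
    have hgc : locAt D μ g * locAt D μ (toLocal μ c) = locAt D μ 1 := by
      rw [← locAt_mul, mul_comm, hg]
    have hcg : locAt D μ (toLocal μ c) * locAt D μ g = locAt D μ 1 := by rw [← locAt_mul, hg]
    have h1g : locAt D μ 1 * locAt D μ g = locAt D μ g := by rw [← locAt_mul, one_mul]
    have hg1 : locAt D μ g * locAt D μ 1 = locAt D μ g := by rw [← locAt_mul, mul_one]
    -- With `g = c⁻¹` on the `λ`-weight space, `T g = (g c) T g = g T (c g) = g T`, where the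
    -- idempotent `1_λ` stands in for the identity.
    have key : ∀ v, T (V.ρ (locAt D μ g) v) = W.ρ (locAt D μ g) (T v) := fun v => by
      rw [← h1g, map_mul V.ρ, Module.End.mul_apply, hone, ← hgc, map_mul W.ρ,
        Module.End.mul_apply, ← hpoly, ← Module.End.mul_apply (V.ρ _), ← map_mul V.ρ, hcg, hone,
        ← Module.End.mul_apply (W.ρ _), ← map_mul W.ρ, hg1, hgc,
        h1g]
    intro v
    rw [locAt_mul, map_mul, map_mul, Module.End.mul_apply, Module.End.mul_apply, key, hpoly]
  | arr i μ => exact hT _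
  | add x y hx hy => exact FinRep.commutes_add hx hy
  | zero => exact FinRep.commutes_zero T
  | mul x y hx hy => exact FinRep.commutes_mul hx hy
  | smul r x hx => exact FinRep.commutes_smul r hx

instance (D : Datum P b k) : (pullbackFunctor.{w} D).Faithful :=
  FinRep.pullback_faithful (quiverHeckeIncl D) (incl_idem D)

instance (D : Datum P b k) : (pullbackFunctor.{w} D).Full :=
  FinRep.pullback_full (quiverHeckeIncl D) (incl_idem D)
    fun _ _ _ hT => commutes_of_commutes_quiverHecke hT

theorem incl_polyAt (D : Datum P b k) (μ : Weight k X) (a : PolyAlg k X) :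
    quiverHeckeIncl D (polyAt D μ a) = locAt D μ (toLocal μ a) := rfl

/-- The action of polynomials on `V` is not unital, as `1` acts by the projection `1_λ`; this
accounts for the last factor. -/
theorem polyEnd_aeval (V : FinRep.{w} (k := k) (idem D)) (μ : Weight k X) (a : PolyAlg k X)
    (p : Polynomial k) :
    polyEnd V μ (Polynomial.aeval a p) =
      Polynomial.aeval (polyEnd V μ a) p * polyEnd V μ 1 := by
  induction p using Polynomial.induction_on with
  | C r =>
    rw [Polynomial.aeval_C, Polynomial.aeval_C, Algebra.algebraMap_eq_smul_one, map_smul,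
      ← Algebra.smul_def]
  | add p q hp hq => rw [map_add, map_add, map_add, add_mul, hp, hq]
  | monomial n r h =>
    rw [pow_succ', mul_left_comm, map_mul (Polynomial.aeval a) Polynomial.X,
      map_mul (Polynomial.aeval (polyEnd V μ a)) Polynomial.X, Polynomial.aeval_X,
      Polynomial.aeval_X, map_mul, h, mul_assoc]

/-- On a representation on which the polynomials not vanishing at `λ` act cancellably on `1_λ V`,
polynomials vanishing at `λ` act nilpotently on `1_λ V`. -/
theorem exists_polyEnd_pow_eq_zero (W : FinRep.{w} (k := k) (idem D)) {μ : Weight k X}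
    (hW : ∀ x c : PolyAlg k X, μ c ≠ 0 → polyEnd W μ (x * c) = 0 → polyEnd W μ x = 0)
    {a : PolyAlg k X} (ha : μ a = 0) : ∃ N : ℕ, ∀ n ≥ N, polyEnd W μ (a ^ n) = 0 := by
  have hm : minpoly k (polyEnd W μ a) ≠ 0 :=
    minpoly.ne_zero (Algebra.IsIntegral.isIntegral (R := k) (polyEnd W μ a))
  obtain ⟨q, hq, hq0⟩ := Polynomial.exists_eq_pow_rootMultiplicity_mul_and_not_dvd _ hm 0
  rw [Polynomial.C_0, sub_zero] at hq hq0
  set N := (minpoly k (polyEnd W μ a)).rootMultiplicity 0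
  -- Since `a(λ) = 0`, the value of `q(a)` at `λ` is the constant term of `q`.
  have hc : μ (Polynomial.aeval a q) ≠ 0 := by
    rw [← Polynomial.aeval_algHom_apply, ha, ← Polynomial.coeff_zero_eq_aeval_zero]
    rwa [Polynomial.X_dvd_iff] at hq0
  have h0 : polyEnd W μ (a ^ N * Polynomial.aeval a q) = 0 := by
    have := polyEnd_aeval W μ a (minpoly k (polyEnd W μ a))
    rw [minpoly.aeval, zero_mul, hq, map_mul, map_pow, Polynomial.aeval_X] at this
    exact this
  refine ⟨N, fun n hn => ?_⟩
  rw [← Nat.sub_add_cancel hn, pow_add, map_mul, hW _ _ hc h0, mul_zero]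

/-- The inverse of `c` in `A_λ` also acts, since `V` is a representation of the localized algebra.
-/
theorem polyEnd_pullback_cancel (V : FinRep.{w} (k := k) (localizedIdem D)) {μ : Weight k X}
    (x c : PolyAlg k X) (hc : μ c ≠ 0)
    (h : polyEnd ((pullbackFunctor D).obj V) μ (x * c) = 0) :
    polyEnd ((pullbackFunctor D).obj V) μ x = 0 := by
  obtain ⟨g, hg⟩ := exists_toLocal_mul_eq_one hc
  have hz : quiverHeckeIncl D (polyAt D μ (x * c)) * locAt D μ g =
      quiverHeckeIncl D (polyAt D μ x) := by
    rw [incl_polyAt, incl_polyAt, ← locAt_mul, toLocal_mul, mul_assoc, hg, mul_one]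
  exact FinRep.pullback_ρ_eq_zero_of_mul (quiverHeckeIncl D) (incl_idem D) V hz h

theorem pullback_isNilpotentOn (V : FinRep.{w} (k := k) (localizedIdem D)) (S : Set X) :
    IsNilpotentOn D S ((pullbackFunctor D).obj V) := fun μ x _ =>
  exists_polyEnd_pow_eq_zero _ (polyEnd_pullback_cancel V)
    (by rw [map_sub, AlgHom.commutes, Algebra.algebraMap_self_apply, sub_self])

theorem IsLocalizable.exists_pullback_iso {V : FinRep.{w} (k := k) (idem D)}
    (hV : IsLocalizable V) (hD : D.IsPolynomial) :
    ∃ W, Nonempty ((pullbackFunctor.{w} D).obj W ≅ V) :=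
  ⟨V.ofAction (hV.localizedAction hD) fun μ => by
      rw [← incl_idem, hV.localizedAction_incl],
    ⟨FinRep.pullbackOfActionIso (quiverHeckeIncl D) (incl_idem D) V _ _
      (hV.localizedAction_incl hD)⟩⟩

/-- Both parts are instances: the only demand on `S` is that it span `k ⊗ X`, which is the
hypothesis of (a) for the simple roots and automatic for all of `X`. -/
theorem pullbackIsEquivalenceOnto (hD : D.IsPolynomial) {S : Set X}
    (hS : Submodule.span k ((fun x : X => (1 : k) ⊗ₜ[ℤ] x) '' S) = ⊤) :
    PullbackIsEquivalenceOnto.{w} D (IsNilpotentOn.{w} D S) := by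
  refine ⟨fun V => pullback_isNilpotentOn V S, { essSurj := ⟨fun V => ?_⟩ }⟩
  have hV := isLocalizable_of_isNilpotentOn V.obj hS V.property
  obtain ⟨W, ⟨e⟩⟩ := hV.exists_pullback_iso hD
  exact ⟨W, ⟨ObjectProperty.isoMk _ e⟩⟩

theorem span_one_tmul_univ (k X : Type*) [Field k] [AddCommGroup X] :
    Submodule.span k ((fun x : X => (1 : k) ⊗ₜ[ℤ] x) '' Set.univ) = ⊤ := by
  have h := Submodule.baseChange_span (A := k) (Set.univ : Set X) (R := ℤ)
  rw [Submodule.span_univ, Submodule.baseChange_top] at h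
  exact h.symm

end Pullback

end QuiverHecke

end

theorem mainTheorem12 {ι k X Y : Type*}
    [Finite ι] [Field k]
    [AddCommGroup X] [Module.Free ℤ X] [Module.Finite ℤ X]
    [AddCommGroup Y] [Module.Free ℤ Y] [Module.Finite ℤ Y]
    (P : RootDatum ι X Y) [P.IsReduced] (b : P.Base)
    (hP : QuiverHecke.IsSimplyConnectedSemisimple P b)
    (H : QuiverHecke.Datum P b k) (hH : H.IsPolynomial) :
    (Submodule.span k
        (Set.range fun i : b.support => (1 : k) ⊗ₜ[ℤ] P.root i) = ⊤ →
      QuiverHecke.PullbackIsEquivalenceOnto.{w} H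
        (QuiverHecke.IsNilpotentOn.{w} H (P.root '' b.support))) ∧
    QuiverHecke.PullbackIsEquivalenceOnto.{w} H
      (QuiverHecke.IsNilpotentOn.{w} H Set.univ) := by
  refine ⟨fun h => QuiverHecke.pullbackIsEquivalenceOnto hH ?_,
    QuiverHecke.pullbackIsEquivalenceOnto hH (QuiverHecke.span_one_tmul_univ k X)⟩
  rw [← h, Set.image_image]
  congr 1
  ext v
  simp
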